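/- Let $\ell\ge 0$. Write the ordered standard basis of $\mathbb{C}^{2\ell+1}$ as $e_1,\dots,e_\ell,e_0,e_{-\ell},\dots,e_{-1}$, and let $\beta$ be the symmetric bilinear form with $\beta(e_j,e_k)=\delta_{j,-k}$. Let $SO(2\ell+1)$ be the group of $g\in SL(2\ell+1,\mathbb{C})$ preserving $\beta$, let $K\cong SO(2\ell)$ be the subgroup of elements fixing $e_0$, and let $B_{2\ell}\subset K$ be the subgroup of upper triangular matrices in $K$. A maximal isotropic flag is a chain $\mathcal{F}=(V_1\subset\dots\subset V_\ell)$ of subspaces of $\mathbb{C}^{2\ell+1}$ with $\dim V_i=i$ and $\beta|_{V_i\times V_i}=0$; the group $B_{2\ell}$ acts on these flags. Write $\mathcal{F}=(v_1\subset\dots\subset v_\ell)$ if $V_i=\mathrm{span}\{v_1,\dots,v_i\}$ for all $i$. For $1\le i\le\ell$ let $\hat e_i:=e_i+\sqrt2\,e_0-e_{-i}$ (hat vector of the first kind, of index $i$), and for $1\le j<i\le \ell$ let $\hat e_{i,-j}:=\hat e_i+e_{-j}$ (hat vector of the second kind, of index $j$); the standard basis vector $e_j$, $-\ell\le j\le\ell$,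 has index $|j|$. A maximal isotropic flag is in standard form if it can be written as $(v_1\subset\dots\subset v_\ell)$ where each $v_i$ is a standard basis vector or a hat vector of the first or second kind, such that (a) if $v_i$ is a hat vector of the first kind, then $v_k$ is a standard basis vector for all $k>i$; (b) if $i<k$, $v_i=\hat e_{a,-j}$ and $v_k=\hat e_{a,-j'}$, then $j<j'$; (c) each integer in $\{1,\dots,\ell\}$ is the index of exactly one $v_i$. A signed list is a finite sequence of integers with pairwise distinct absolute values. Let $SPIL(\ell\cup\{0\})$ be the set of all sets $\Sigma$ of nonempty signed lists such that each element of $\{0,1,\dots,\ell\}$ is the absolute value of an entry of exactly one list in $\Sigma$, all entries of the lists have absolute value in $\{0,\dots,\ell\}$, the last entry of every list is non-negative, and $0$ occurs only as a last entry. Theorem. (1) The map $\mathcal{F}\mapsto B_{2\ell}\cdot\mathcal{F}$ is a bijection from the set of maximal isotropic flags in standard form to the set of $B_{2\ell}$-orbits on maximal isotropic flags in $\mathbb{C}^{2\ell+1}$; that is, every orbit contains exactly one flag in standard form. (2) There is a bijection $\Gamma$ from $SPIL(\ell\cup\{0\})$ to the set of maximal isotropic flags in standard form, given as follows. For $\Sigma\in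 SPIL(\ell\cup\{0\})$ write $\Sigma=\{\sigma_1,\dots,\sigma_t\}$ with $\sigma_j=(i_{j,1},\dots,i_{j,k_j})$, $i_{1,k_1}<\dots<i_{t-1,k_{t-1}}$ and $0\in\sigma_t$, and, if $t\ge2$, put $a=i_{t-1,k_{t-1}}$. Then $\Gamma(\Sigma)=(v_1\subset\dots\subset v_\ell)$, where $v_1,\dots,v_\ell$ is obtained by concatenating the sequences $e_{i_{j,1}},\dots,e_{i_{j,k_j-1}},\hat e_{a,-i_{j,k_j}}$ for $j=1,\dots,t-2$, then (if $t\ge 2$) $e_{i_{t-1,1}},\dots,e_{i_{t-1,k_{t-1}-1}},\hat e_a$, and finally $e_{i_{t,1}},\dots,e_{i_{t,k_t-1}}$. -/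

import Mathlib

namespace OrthFlag

noncomputable section

/-! ### The quadratic space and the groups -/

/-- Column vectors of length `n` over the complex numbers. -/
abbrev Vec (n : ℕ) : Type := Fin n → ℂ

/-- The permutation matrix `S_n` exchanging the `i`-th and the `(n+1-i)`-th basis vector. -/
def antiDiag (n : ℕ) : Matrix (Fin n) (Fin n) ℂ :=
  Matrix.of fun i j => if j = Fin.rev i then 1 else 0

/-- The symmetric bilinear form `β(x, y) = xᵀ S_n y`. -/
def form {n : ℕ} (x y : Vec n) : ℂ :=
  x ⬝ᵥ (antiDiag n).mulVec y

/-- The special orthogonal group of `β`, as a subgroup of `SL(n)`. -/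
def SO (n : ℕ) : Subgroup (Matrix.SpecialLinearGroup (Fin n) ℂ) where
  carrier := {g | ∀ x y : Vec n, form (g.1.mulVec x) (g.1.mulVec y) = form x y}
  one_mem' := by
    intro x y
    simp
  mul_mem' := by
    intro g h hg hh x y
    have := hg (h.1.mulVec x) (h.1.mulVec y)
    simp only [Matrix.mulVec_mulVec] at this
    simp only [Matrix.SpecialLinearGroup.coe_mul]
    rw [this]
    exact hh x y
  inv_mem' := by
    intro g hg x y
    have h1 : g.1 * (g⁻¹).1 = 1 := by
      rw [← Matrix.SpecialLinearGroup.coe_mul, mul_inv_cancel, Matrix.SpecialLinearGroup.coe_one]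
    have := hg ((g⁻¹).1.mulVec x) ((g⁻¹).1.mulVec y)
    simp only [Matrix.mulVec_mulVec, h1, Matrix.one_mulVec] at this
    exact this.symm

/-- The signed label of a coordinate: the ordered basis of `ℂ^(2ℓ+1)` is
`e_1, …, e_ℓ, e_0, e_{-ℓ}, …, e_{-1}`. -/
def coordLabel (ℓ : ℕ) (k : Fin (2 * ℓ + 1)) : ℤ :=
  if (k : ℕ) < ℓ then (k : ℤ) + 1 else if (k : ℕ) = ℓ then 0 else (k : ℤ) - (2 * ℓ + 1)

/-- The standard basis vector `e_j`, `-ℓ ≤ j ≤ ℓ` (and `0` for other `j`). -/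
def e (ℓ : ℕ) (j : ℤ) : Vec (2 * ℓ + 1) :=
  fun k => if coordLabel ℓ k = j then 1 else 0

/-- `K = SO(2ℓ)`, realized in `SO(2ℓ+1)` as the elements fixing `e_0`. -/
def K (ℓ : ℕ) : Subgroup (SO (2 * ℓ + 1)) where
  carrier := {g | g.1.1.mulVec (e ℓ 0) = e ℓ 0}
  one_mem' := by simp
  mul_mem' := by
    intro g h hg hh
    simp only [Set.mem_ofPred_eq, Subgroup.coe_mul, Matrix.SpecialLinearGroup.coe_mul] at *
    rw [← Matrix.mulVec_mulVec, hh, hg]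
  inv_mem' := by
    intro g hg
    simp only [Set.mem_ofPred_eq] at *
    have h1 : (g⁻¹).1.1 * g.1.1 = 1 := by
      rw [← Matrix.SpecialLinearGroup.coe_mul, ← Subgroup.coe_mul, inv_mul_cancel,
        Subgroup.coe_one, Matrix.SpecialLinearGroup.coe_one]
    conv_lhs => rw [← hg]
    rw [Matrix.mulVec_mulVec, h1, Matrix.one_mulVec]

/-- The standard Borel subgroup of upper triangular matrices in `SO(n)`. -/
def upperBorel (n : ℕ) : Subgroup (SO n) where
  carrier := {g | ∀ i j : Fin n, j < i → g.1.1 i j = 0}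
  one_mem' := by
    intro i j hij
    simp [hij.ne']
  mul_mem' := by
    intro g h hg hh
    exact Matrix.BlockTriangular.mul (b := id) hg hh
  inv_mem' := by
    intro g hg
    have h1 : g.1.1 * (g⁻¹).1.1 = 1 := by
      rw [← Matrix.SpecialLinearGroup.coe_mul, ← Subgroup.coe_mul, mul_inv_cancel,
        Subgroup.coe_one, Matrix.SpecialLinearGroup.coe_one]
    let _ : Invertible g.1.1 := ⟨(g⁻¹).1.1, mul_eq_one_comm.mp h1, h1⟩
    have h2 : (g⁻¹).1.1 = (g.1.1)⁻¹ := (Matrix.inv_eq_right_inv h1).symm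
    have h3 : Matrix.BlockTriangular (g.1.1)⁻¹ id :=
      Matrix.blockTriangular_inv_of_blockTriangular hg
    intro i j hij
    rw [h2]
    exact h3 hij

/-- `B_{2ℓ} = K ∩ B_{2ℓ+1}`, the upper triangular Borel subgroup of `K = SO(2ℓ)`. -/
def B (ℓ : ℕ) : Subgroup (SO (2 * ℓ + 1)) := K ℓ ⊓ upperBorel (2 * ℓ + 1)

/-! ### Maximal isotropic flags -/

/-- A maximal isotropic flag `V_1 ⊂ ⋯ ⊂ V_ℓ` in `ℂ^(2ℓ+1)`; `V i` has dimension `i + 1`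
since `i : Fin ℓ` starts at `0`. -/
@[ext]
structure IsoFlag (ℓ : ℕ) where
  V : Fin ℓ → Submodule ℂ (Vec (2 * ℓ + 1))
  mono : Monotone V
  finrank_eq : ∀ i, Module.finrank ℂ (V i) = (i : ℕ) + 1
  isotropic : ∀ i, ∀ u ∈ V i, ∀ w ∈ V i, form u w = 0

/-- `SO(2ℓ+1)` acts on maximal isotropic flags by `(g · F)_i = g(V_i)`. -/
instance (ℓ : ℕ) : MulAction (SO (2 * ℓ + 1)) (IsoFlag ℓ) where
  smul g F :=
    { V := fun i => (F.V i).map (Matrix.mulVecLin g.1.1)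
      mono := fun _ _ h => Submodule.map_mono (F.mono h)
      finrank_eq := by
        intro i
        rw [← F.finrank_eq i]
        have hinj : Function.Injective (Matrix.mulVecLin g.1.1) := by
          have h1 : (g⁻¹).1.1 * g.1.1 = 1 := by
            rw [← Matrix.SpecialLinearGroup.coe_mul, ← Subgroup.coe_mul, inv_mul_cancel,
              Subgroup.coe_one, Matrix.SpecialLinearGroup.coe_one]
          intro x y hxy
          have := congrArg (fun v => ((g⁻¹).1.1).mulVec v) hxy
          simpa only [Matrix.mulVecLin_apply, Matrix.mulVec_mulVec, h1, Matrix.one_mulVec] using this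
        exact (LinearEquiv.finrank_eq (Submodule.equivMapOfInjective _ hinj (F.V i))).symm
      isotropic := by
        rintro i _ ⟨u, hu, rfl⟩ _ ⟨w, hw, rfl⟩
        rw [Matrix.mulVecLin_apply, Matrix.mulVecLin_apply, g.2 u w]
        exact F.isotropic i u hu w hw }
  one_smul F := by
    apply IsoFlag.ext
    funext i
    change (F.V i).map (Matrix.mulVecLin (1 : Matrix _ _ ℂ)) = F.V i
    rw [Matrix.mulVecLin_one, Submodule.map_id]
  mul_smul g h F := by
    apply IsoFlag.ext
    funext i
    change (F.V i).map (Matrix.mulVecLin (g.1.1 * h.1.1)) =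
      ((F.V i).map (Matrix.mulVecLin h.1.1)).map (Matrix.mulVecLin g.1.1)
    rw [Matrix.mulVecLin_mul, Submodule.map_comp]

/-- `F = (v_1 ⊂ ⋯ ⊂ v_ℓ)`, that is `V_i = span {v_1, …, v_i}` for every `i`. -/
def IsoFlag.SpannedBy {ℓ : ℕ} (F : IsoFlag ℓ) (v : Fin ℓ → Vec (2 * ℓ + 1)) : Prop :=
  ∀ i, F.V i = Submodule.span ℂ (v '' Set.Iic i)

/-! ### Flags in standard form -/

/-- Names of the vectors allowed in a flag in standard form: `basis j` stands for `e_j`,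
`hatOne i` for the hat vector `ê_i` of the first kind, and `hatTwo i j` for the hat vector
`ê_{i,-j}` of the second kind. -/
inductive StdVec where
  | basis (j : ℤ)
  | hatOne (i : ℤ)
  | hatTwo (i j : ℤ)

/-- The range of the parameters. -/
def StdVec.Valid (ℓ : ℕ) : StdVec → Prop
  | .basis j => -(ℓ : ℤ) ≤ j ∧ j ≤ ℓ
  | .hatOne i => 1 ≤ i ∧ i ≤ ℓ
  | .hatTwo i j => 1 ≤ j ∧ j < i ∧ i ≤ ℓ

/-- `ê_i = e_i + √2 e_0 - e_{-i}`. -/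
def hat (ℓ : ℕ) (i : ℤ) : Vec (2 * ℓ + 1) :=
  e ℓ i + ((Real.sqrt 2 : ℝ) : ℂ) • e ℓ 0 - e ℓ (-i)

/-- The vector with a given name; `ê_{i,-j} = ê_i + e_{-j}`. -/
def StdVec.toVec (ℓ : ℕ) : StdVec → Vec (2 * ℓ + 1)
  | .basis j => e ℓ j
  | .hatOne i => hat ℓ i
  | .hatTwo i j => hat ℓ i + e ℓ (-j)

/-- The index: `|j|` for `e_j`, `i` for `ê_i`, and `j` for `ê_{i,-j}`. -/
def StdVec.index : StdVec → ℤ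
  | .basis j => |j|
  | .hatOne i => i
  | .hatTwo _ j => j

/-- The conditions on the sequence `v_1, …, v_ℓ` of a flag in standard form. -/
structure IsStdSeq (ℓ : ℕ) (v : Fin ℓ → StdVec) : Prop where
  valid : ∀ i, (v i).Valid ℓ
  /-- After a hat vector of the first kind only standard basis vectors occur. -/
  after_hatOne : ∀ i a, v i = .hatOne a → ∀ k, i < k → ∃ j, v k = .basis j
  /-- The indices of hat vectors `ê_{a,-j}` with the same `a` increase along the flag. -/
  hatTwo_lt : ∀ i k, i < k → ∀ a j j', v i = .hatTwo a j → v k = .hatTwo a j' → j < j'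
  /-- Each of `1, …, ℓ` is the index of exactly one `v_i`. -/
  index_unique : ∀ m : ℤ, 1 ≤ m → m ≤ ℓ → ∃! i, (v i).index = m

/-- A maximal isotropic flag in standard form. -/
def IsoFlag.IsStandard {ℓ : ℕ} (F : IsoFlag ℓ) : Prop :=
  ∃ v : Fin ℓ → StdVec, IsStdSeq ℓ v ∧ F.SpannedBy fun i => (v i).toVec ℓ

/-! ### Signed partitions into lists -/

/-- A partition into lists (PIL) of a finite set `A`: a set of nonempty lists without repetition
such that every element of `A` lies in exactly one of the lists. -/
def IsPIL (A : Finset ℕ) (P : Set (List ℕ)) : Prop :=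
  (∀ σ ∈ P, σ ≠ [] ∧ σ.Nodup ∧ ∀ x ∈ σ, x ∈ A) ∧ ∀ a ∈ A, ∃! σ, σ ∈ P ∧ a ∈ σ

/-- `|σ|`, the list of absolute values of a signed list. -/
def absList (σ : List ℤ) : List ℕ := σ.map Int.natAbs

/-- A signed list of `A`: entries in `±A`, no two of them equal up to sign. -/
def IsSignedList (A : Finset ℕ) (σ : List ℤ) : Prop :=
  (∀ x ∈ σ, x.natAbs ∈ A) ∧ (absList σ).Nodup

/-- A signed PIL (SPIL) of `A`: signed lists `σ_1, …, σ_k` such that the `k` lists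
`|σ_1|, …, |σ_k|` form a PIL of `A` (distinct `σ_i` having distinct `|σ_i|`), the last entry of
each `σ_i` is non-negative, and `0` can only occur as a last entry. -/
structure IsSPIL (A : Finset ℕ) (S : Set (List ℤ)) : Prop where
  signed : ∀ σ ∈ S, IsSignedList A σ
  inj : Set.InjOn absList S
  pil : IsPIL A (absList '' S)
  last_nonneg : ∀ σ ∈ S, ∀ x ∈ σ.getLast?, 0 ≤ x
  zero_last : ∀ σ ∈ S, (0 : ℤ) ∈ σ → σ.getLast? = some 0

/-- `SPIL(ℓ ∪ {0})`, the set of SPILs of `{0, 1, …, ℓ}`. -/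
abbrev SPIL (ℓ : ℕ) : Type := {S : Set (List ℤ) // IsSPIL (Finset.range (ℓ + 1)) S}

/-- The standard ordering of a SPIL `S` of `{0, …, ℓ}`: the list containing `0` is `τ` followed
by `0` and comes last; the other lists are the members of `L`, with increasing last entries. -/
structure IsOrdering (S : Set (List ℤ)) (L : List (List ℤ)) (τ : List ℤ) : Prop where
  mem_iff : ∀ σ, σ ∈ S ↔ σ ∈ L ∨ σ = τ ++ [0]
  zero_notMem : ∀ σ ∈ L, (0 : ℤ) ∉ σ
  increasing : L.Pairwise fun σ σ' => σ.getLastD 0 < σ'.getLastD 0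

/-- The sequence of vectors attached to an ordered SPIL. With `a` the last entry of the last member
of `L`, a list `(i_1, …, i_k)` in `L` gives `e_{i_1}, …, e_{i_{k-1}}` followed by `ê_a` if
`i_k = a` and by `ê_{a,-i_k}` otherwise; finally the entries `i` of `τ` give `e_i`. -/
def spilSeq (L : List (List ℤ)) (τ : List ℤ) : List StdVec :=
  let a : ℤ := (L.getLastD []).getLastD 0
  (L.flatMap fun σ => σ.dropLast.map StdVec.basis ++
    [if σ.getLastD 0 = a then StdVec.hatOne a else StdVec.hatTwo a (σ.getLastD 0)]) ++
  τ.map StdVec.basis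

end

end OrthFlag

namespace OrthFlag

noncomputable section

/-! ### The form and the Borel subgroup -/

/-! Elements of `B` are the upper triangular isometries fixing `e 0`; the determinant condition is
then automatic. `IsBorelMap` records such maps as linear maps.

Uniqueness rests on two invariants. Triangularity preserves the lead (last non-zero coordinate) of a
vector, and fixing `e 0` preserves the `e 0`-coordinate. The vectors of a standard sequence have
distinct leads, so the leads are read off from the orbit (`lead_eq_of_borelMap`). A hat vector has
`e 0`-coordinate √2 and a basis vector has 0. Since the indices of hat vectors increase along the
flag, no vector of V_i with `e 0`-coordinate 0 has the lead of a hat vector v_i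
(`IsStdSeq.not_hasLead_of_isHat`); hence the positions of the hat vectors are determined as well. By
isotropy all hat vectors share one parameter a, and ê_a itself occurs, so a is the largest index of
a hat vector. This gives `stdSeq_eq_of_borelMap`.

Existence is an induction on ℓ that splits off the hyperbolic plane of e_1 and e_{-1}. Some basis
adapted to the flag has all members but one orthogonal to e_1 (`IsoFlag.exists_adapted`). Modulo e_1
those members form a flag in ℂ^(2ℓ+1); a unipotent element removes their e_1-components and the
induction hypothesis standardizes them. The exceptional vector is e_1, or has e_{-1}-coefficient 1.
In the latter case unipotent and torus elements fixing the other vectors, together with subtraction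
of an earlier vector of the flag, turn it into a multiple of e_{-1}, ê_1 or ê_{a,-1}
(`exists_std_of_inner`).

For the second part, a standard sequence is cut after each hat vector (`splitHats`). Conditions (a)
and (b) become the increase of the last entries, condition (c) becomes the partition of {1, …, ℓ},
and the common parameter a is recovered as the largest last entry. Thus cutting and `spilSeq` are
mutually inverse (`IsSpilData.exists_stdSeq`, `IsStdSeq.exists_isSpilData`). -/

lemma form_eq_sum {n : ℕ} (x y : Vec n) : form x y = ∑ i, x i * y (Fin.rev i) := by
  simp [form, dotProduct, Matrix.mulVec, antiDiag]

/-- The form as a bilinear map. -/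
def formB (n : ℕ) : LinearMap.BilinForm ℂ (Vec n) :=
  LinearMap.mk₂ ℂ form
    (by intro x x' y; simp [form_eq_sum, add_mul, Finset.sum_add_distrib])
    (by intro c x y; simp [form_eq_sum, Finset.mul_sum, mul_assoc])
    (by intro x y y'; simp [form_eq_sum, mul_add, Finset.sum_add_distrib])
    (by intro c x y; simp [form_eq_sum, Finset.mul_sum, mul_left_comm])

lemma formB_apply {n : ℕ} (x y : Vec n) : formB n x y = form x y := rfl

section Bilinear

variable {n : ℕ} (x x' y y' : Vec n) (c : ℂ)

lemma form_add_left : form (x + x') y = form x y + form x' y := by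
  simp [← formB_apply]

lemma form_add_right : form x (y + y') = form x y + form x y' := by
  simp [← formB_apply]

lemma form_sub_left : form (x - x') y = form x y - form x' y := by
  simp [← formB_apply]

lemma form_sub_right : form x (y - y') = form x y - form x y' := by
  simp [← formB_apply]

lemma form_smul_left : form (c • x) y = c * form x y := by
  simp [← formB_apply]

lemma form_smul_right : form x (c • y) = c * form x y := by
  simp [← formB_apply]

lemma form_zero_left : form 0 y = 0 := by
  simp [← formB_apply]

lemma form_zero_right : form x 0 = 0 := by
  simp [← formB_apply]

lemma form_comm : form x y = form y x := by
  rw [form_eq_sum, form_eq_sum, ← Equiv.sum_comp Fin.revPerm]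
  simp [mul_comm]

end Bilinear

lemma form_single_right {n : ℕ} (x : Vec n) (k : Fin n) :
    form x (Pi.single k 1) = x (Fin.rev k) := by
  rw [form_eq_sum, Finset.sum_eq_single (Fin.rev k)]
  · simp
  · intro i _ hi
    have : Fin.rev i ≠ k := fun h => hi (by rw [← h, Fin.rev_rev])
    simp [this]
  · simp

/-- A subspace spanned by pairwise orthogonal isotropic vectors is isotropic. -/
lemma form_eq_zero_of_mem_span {n : ℕ} {s : Set (Vec n)}
    (hs : ∀ u ∈ s, ∀ w ∈ s, form u w = 0) :
    ∀ u ∈ Submodule.span ℂ s, ∀ w ∈ Submodule.span ℂ s, form u w = 0 := by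
  intro u hu w hw
  induction hu using Submodule.span_induction with
  | zero => exact form_zero_left _
  | add x y _ _ hx hy => rw [form_add_left, hx, hy, add_zero]
  | smul c x _ hx => rw [form_smul_left, hx, mul_zero]
  | mem x hx =>
    induction hw using Submodule.span_induction with
    | zero => exact form_zero_right _
    | add y z _ _ hy hz => rw [form_add_right, hy, hz, add_zero]
    | smul c y _ hy => rw [form_smul_right, hy, mul_zero]
    | mem y hy => exact hs x hx y hy

lemma formB_nondegenerate (n : ℕ) : (formB n).Nondegenerate := by
  have h : ∀ x : Vec n, (∀ y, form x y = 0) → x = 0 := by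
    intro x hx
    funext k
    simpa [form_single_right] using hx (Pi.single (Fin.rev k) 1)
  refine ⟨fun x hx => h x hx, fun x hx => h x fun y => ?_⟩
  rw [form_comm]
  exact hx y

/-- An isotropic U lies in its orthogonal complement, which has dimension n − dim U by
nondegeneracy. -/
lemma two_mul_finrank_le_of_isotropic {n : ℕ} (U : Submodule ℂ (Vec n))
    (hU : ∀ u ∈ U, ∀ w ∈ U, form u w = 0) : 2 * Module.finrank ℂ U ≤ n := by
  have h1 := LinearMap.BilinForm.finrank_orthogonal (formB_nondegenerate n) U
  have h2 : U ≤ (formB n).orthogonal U := fun u hu w hw => hU w hw u hu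
  have h3 := Submodule.finrank_mono h2
  rw [h1, Module.finrank_fin_fun] at h3
  have h4 := Submodule.finrank_le U
  rw [Module.finrank_fin_fun] at h4
  omega

/-! ### Signed labels of the coordinates and Borel maps -/

lemma coordLabel_injective (ℓ : ℕ) : Function.Injective (coordLabel ℓ) := by
  intro k k' h
  have := k.2
  have := k'.2
  unfold coordLabel at h
  ext
  split_ifs at h <;> omega

lemma coordLabel_rev (ℓ : ℕ) (k : Fin (2 * ℓ + 1)) :
    coordLabel ℓ (Fin.rev k) = -coordLabel ℓ k := by
  have := k.2
  unfold coordLabel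
  rw [Fin.val_rev]
  split_ifs <;> omega

lemma exists_coordLabel_eq {ℓ : ℕ} {j : ℤ} (h1 : -(ℓ : ℤ) ≤ j) (h2 : j ≤ ℓ) :
    ∃ k, coordLabel ℓ k = j := by
  rcases lt_trichotomy j 0 with h | h | h
  · refine ⟨⟨(2 * ℓ + 1 + j).toNat, by omega⟩, ?_⟩
    simp only [coordLabel]
    split_ifs <;> omega
  · refine ⟨⟨ℓ, by omega⟩, ?_⟩
    simp [coordLabel, h]
  · refine ⟨⟨(j - 1).toNat, by omega⟩, ?_⟩
    simp only [coordLabel]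
    split_ifs <;> omega

/-- Coordinates with negative label are ordered by their labels, and come last. -/
lemma coordLabel_lt_of_lt {ℓ : ℕ} {k k' : Fin (2 * ℓ + 1)} (h : k < k')
    (hk : coordLabel ℓ k < 0) : coordLabel ℓ k < coordLabel ℓ k' ∧ coordLabel ℓ k' < 0 := by
  have := k'.2
  have h' : (k : ℕ) < k' := h
  unfold coordLabel at *
  split_ifs at hk ⊢ <;> omega

lemma lt_of_coordLabel_lt {ℓ : ℕ} {k k' : Fin (2 * ℓ + 1)}
    (h : coordLabel ℓ k < coordLabel ℓ k') (hk : coordLabel ℓ k' < 0) : k < k' := by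
  rcases lt_trichotomy k k' with h1 | h1 | h1
  · exact h1
  · rw [h1] at h; omega
  · have := (coordLabel_lt_of_lt h1 hk).1
    omega

/-- The coordinate of `e_0`. -/
def mid (ℓ : ℕ) : Fin (2 * ℓ + 1) := ⟨ℓ, by omega⟩

lemma coordLabel_mid (ℓ : ℕ) : coordLabel ℓ (mid ℓ) = 0 := by
  simp [coordLabel, mid]

lemma rev_mid (ℓ : ℕ) : Fin.rev (mid ℓ) = mid ℓ :=
  coordLabel_injective ℓ (by rw [coordLabel_rev, coordLabel_mid, neg_zero])

lemma e_coordLabel (ℓ : ℕ) (k : Fin (2 * ℓ + 1)) : e ℓ (coordLabel ℓ k) = Pi.single k 1 := by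
  funext k'
  simp [e, Pi.single_apply, (coordLabel_injective ℓ).eq_iff]

lemma e_zero (ℓ : ℕ) : e ℓ 0 = Pi.single (mid ℓ) 1 := by
  rw [← coordLabel_mid ℓ, e_coordLabel]

lemma form_e_zero (ℓ : ℕ) (x : Vec (2 * ℓ + 1)) : form x (e ℓ 0) = x (mid ℓ) := by
  rw [e_zero, form_single_right, rev_mid]

lemma form_e_e {ℓ : ℕ} (i : ℤ) {j : ℤ} (h1 : -(ℓ : ℤ) ≤ j) (h2 : j ≤ ℓ) :
    form (e ℓ i) (e ℓ j) = if i = -j then 1 else 0 := by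
  obtain ⟨k, rfl⟩ := exists_coordLabel_eq h1 h2
  rw [e_coordLabel, form_single_right]
  simp [e, coordLabel_rev, eq_comm]

/-- Linear maps given by the elements of `B ℓ`. -/
structure IsBorelMap (ℓ : ℕ) (f : Vec (2 * ℓ + 1) →ₗ[ℂ] Vec (2 * ℓ + 1)) : Prop where
  isometry : ∀ x y, form (f x) (f y) = form x y
  map_e_zero : f (e ℓ 0) = e ℓ 0
  -- Upper triangularity, expressed as invariance of the initial coordinate subspaces.
  triangular : ∀ k x, (∀ i, k < i → x i = 0) → ∀ i, k < i → f x i = 0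

lemma IsBorelMap.id (ℓ : ℕ) : IsBorelMap ℓ LinearMap.id :=
  ⟨fun _ _ => rfl, rfl, fun _ _ h => h⟩

lemma IsBorelMap.comp {ℓ : ℕ} {f g : Vec (2 * ℓ + 1) →ₗ[ℂ] Vec (2 * ℓ + 1)}
    (hf : IsBorelMap ℓ f) (hg : IsBorelMap ℓ g) : IsBorelMap ℓ (f ∘ₗ g) where
  isometry x y := by simp [hf.isometry, hg.isometry]
  map_e_zero := by simp [hf.map_e_zero, hg.map_e_zero]
  triangular k x hx := hf.triangular k _ (hg.triangular k x hx)

/-- The form of vectors supported on complementary initial segments. -/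
lemma form_eq_mul {n : ℕ} {x y : Vec n} (k : Fin n) (hx : ∀ i, k < i → x i = 0)
    (hy : ∀ i, Fin.rev k < i → y i = 0) : form x y = x k * y (Fin.rev k) := by
  rw [form_eq_sum, Finset.sum_eq_single k]
  · intro i _ hi
    rcases lt_or_gt_of_ne hi with h | h
    · rw [hy _ (Fin.rev_lt_rev.mpr h), mul_zero]
    · rw [hx i h, zero_mul]
  · simp

lemma single_eq_zero_of_lt {n : ℕ} (k : Fin n) : ∀ i, k < i → (Pi.single k 1 : Vec n) i = 0 := by
  intro i hi
  simp [hi.ne']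

/-- By triangularity a single term survives when f x is paired with the image of the basis vector at
`Fin.rev k`, and the isometry evaluates it. Consequently leads are preserved, and the diagonal
entries at k and `Fin.rev k` are inverse to each other. -/
lemma IsBorelMap.apply_single_mul {ℓ : ℕ} {f : Vec (2 * ℓ + 1) →ₗ[ℂ] Vec (2 * ℓ + 1)}
    (hf : IsBorelMap ℓ f) {x : Vec (2 * ℓ + 1)} {k : Fin (2 * ℓ + 1)}
    (hx : ∀ i, k < i → x i = 0) :
    f x k * f (Pi.single (Fin.rev k) 1) (Fin.rev k) = x k := by
  rw [← form_eq_mul k (hf.triangular k x hx)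
    (hf.triangular _ _ (single_eq_zero_of_lt _)), hf.isometry, form_single_right, Fin.rev_rev]

/-- The middle coordinate is the product with the fixed vector `e ℓ 0`. This invariant separates hat
vectors from basis vectors. -/
lemma IsBorelMap.apply_mid {ℓ : ℕ} {f : Vec (2 * ℓ + 1) →ₗ[ℂ] Vec (2 * ℓ + 1)}
    (hf : IsBorelMap ℓ f) (x : Vec (2 * ℓ + 1)) : f x (mid ℓ) = x (mid ℓ) := by
  rw [← form_e_zero ℓ x, ← hf.isometry x, hf.map_e_zero, form_e_zero]

/-- Diagonal entries at opposite coordinates cancel, and the only coordinate fixed by `Fin.rev` is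
`mid ℓ`, whose entry is 1. -/
lemma IsBorelMap.det_toMatrix' {ℓ : ℕ} {f : Vec (2 * ℓ + 1) →ₗ[ℂ] Vec (2 * ℓ + 1)}
    (hf : IsBorelMap ℓ f) : (LinearMap.toMatrix' f).det = 1 := by
  have htri : (LinearMap.toMatrix' f).BlockTriangular _root_.id := by
    intro i j hij
    rw [LinearMap.toMatrix'_apply]
    have := hf.triangular j _ (single_eq_zero_of_lt j) i hij
    simpa [Pi.single_apply] using this
  rw [Matrix.det_of_isUpperTriangular htri]
  have hd : ∀ i, LinearMap.toMatrix' f i i = f (Pi.single i 1) i := by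
    intro i
    rw [LinearMap.toMatrix'_apply]
  refine Finset.prod_involution (fun i _ => Fin.rev i) ?_ ?_ (fun _ _ => Finset.mem_univ _)
    (fun _ _ => Fin.rev_rev _)
  · intro i _
    rw [hd, hd, hf.apply_single_mul (single_eq_zero_of_lt i), Pi.single_eq_same]
  · intro i _ h hi
    apply h
    have h0 : i = mid ℓ := coordLabel_injective ℓ (by
      have := coordLabel_rev ℓ i
      rw [hi] at this
      rw [coordLabel_mid]
      omega)
    rw [hd, h0, hf.apply_mid, Pi.single_eq_same]

lemma IsBorelMap.exists_mem_B {ℓ : ℕ} {f : Vec (2 * ℓ + 1) →ₗ[ℂ] Vec (2 * ℓ + 1)}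
    (hf : IsBorelMap ℓ f) : ∃ b : B ℓ, Matrix.mulVecLin b.1.1.1 = f := by
  have hv : ∀ x, (LinearMap.toMatrix' f).mulVec x = f x := fun x => LinearMap.toMatrix'_mulVec f x
  refine ⟨⟨⟨⟨LinearMap.toMatrix' f, hf.det_toMatrix'⟩, ?_⟩, ?_, ?_⟩, ?_⟩
  · intro x y
    simp only [hv, hf.isometry]
  · change (LinearMap.toMatrix' f).mulVec (e ℓ 0) = e ℓ 0
    rw [hv, hf.map_e_zero]
  · intro i j hij
    change LinearMap.toMatrix' f i j = 0
    have := hf.triangular j _ (single_eq_zero_of_lt j) i hij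
    rw [← hv, Matrix.mulVec_single_one] at this
    exact this
  · exact LinearMap.ext hv

lemma isBorelMap_of_mem_B {ℓ : ℕ} (b : B ℓ) : IsBorelMap ℓ (Matrix.mulVecLin b.1.1.1) where
  isometry := b.1.2
  map_e_zero := b.2.1
  triangular k x hx i hi := by
    rw [Matrix.mulVecLin_apply]
    change ∑ j, b.1.1.1 i j * x j = 0
    refine Finset.sum_eq_zero fun j _ => ?_
    rcases le_or_gt j k with h | h
    · rw [b.2.2 i j (h.trans_lt hi), zero_mul]
    · rw [hx j h, mul_zero]

/-! ### Leading coordinates -/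

/-- `k` is the last coordinate of `x` which does not vanish. -/
def HasLead {n : ℕ} (x : Vec n) (k : Fin n) : Prop :=
  x k ≠ 0 ∧ ∀ i, k < i → x i = 0

lemma HasLead.unique {n : ℕ} {x : Vec n} {k k' : Fin n} (h : HasLead x k) (h' : HasLead x k') :
    k = k' := by
  rcases lt_trichotomy k k' with hlt | heq | hlt
  · exact absurd (h.2 _ hlt) h'.1
  · exact heq
  · exact absurd (h'.2 _ hlt) h.1

lemma IsBorelMap.hasLead {ℓ : ℕ} {f : Vec (2 * ℓ + 1) →ₗ[ℂ] Vec (2 * ℓ + 1)}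
    (hf : IsBorelMap ℓ f) {x : Vec (2 * ℓ + 1)} {k : Fin (2 * ℓ + 1)} (h : HasLead x k) :
    HasLead (f x) k :=
  ⟨fun h0 => h.1 (by rw [← hf.apply_single_mul h.2, h0, zero_mul]), hf.triangular k x h.2⟩

/-- The lead of a linear combination of vectors with distinct leads. -/
lemma exists_hasLead_sum {n : ℕ} {ι : Type*} [LinearOrder ι] {u : ι → Vec n} {κ : ι → Fin n}
    (hκ : Function.Injective κ) (hu : ∀ i, HasLead (u i) (κ i)) (s : Finset ι) (c : ι → ℂ)
    (hc : ∃ i ∈ s, c i ≠ 0) :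
    ∃ m ∈ s, c m ≠ 0 ∧ HasLead (∑ i ∈ s, c i • u i) (κ m) ∧
      ∀ i ∈ s, c i ≠ 0 → κ i ≤ κ m := by
  classical
  obtain ⟨m, hm, hmax⟩ := (s.filter fun i => c i ≠ 0).exists_max_image κ
    (by obtain ⟨i, hi, h⟩ := hc; exact ⟨i, by simp [hi, h]⟩)
  rw [Finset.mem_filter] at hm
  have hmax' : ∀ i ∈ s, c i ≠ 0 → κ i ≤ κ m := fun i hi h => hmax i (by simp [hi, h])
  refine ⟨m, hm.1, hm.2, ⟨?_, ?_⟩, hmax'⟩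
  · rw [Finset.sum_apply, Finset.sum_eq_single m]
    · exact mul_ne_zero hm.2 (hu m).1
    · intro i hi him
      by_cases h : c i = 0
      · simp [h]
      · have hlt : κ i < κ m := lt_of_le_of_ne (hmax' i hi h) (hκ.ne him)
        simp [(hu i).2 _ hlt]
    · exact fun h => absurd hm.1 h
  · intro k hk
    rw [Finset.sum_apply]
    refine Finset.sum_eq_zero fun i hi => ?_
    by_cases h : c i = 0
    · simp [h]
    · simp [(hu i).2 _ ((hmax' i hi h).trans_lt hk)]

lemma linearIndependent_of_hasLead {n : ℕ} {ι : Type*} [LinearOrder ι] {u : ι → Vec n}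
    {κ : ι → Fin n} (hκ : Function.Injective κ) (hu : ∀ i, HasLead (u i) (κ i)) :
    LinearIndependent ℂ u := by
  rw [linearIndependent_iff']
  intro s c hs
  by_contra! h
  obtain ⟨m, -, -, hm, -⟩ := exists_hasLead_sum hκ hu s c h
  rw [hs] at hm
  exact hm.1 rfl

lemma exists_sum_of_mem_span_image_Iic {n l : ℕ} {u : Fin l → Vec n} {i : Fin l} {x : Vec n}
    (hx : x ∈ Submodule.span ℂ (u '' Set.Iic i)) :
    ∃ c : Fin l → ℂ, x = ∑ m ∈ Finset.Iic i, c m • u m := by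
  rw [← Finset.coe_Iic, Submodule.mem_span_image_finset_iff_exists_fun] at hx
  obtain ⟨c, rfl⟩ := hx
  refine ⟨fun m => if h : m ∈ Finset.Iic i then c ⟨m, h⟩ else 0, ?_⟩
  rw [← Finset.sum_coe_sort (Finset.Iic i)]
  exact Finset.sum_congr rfl fun m _ => by simp only [m.2, dif_pos]

/-! ### The vectors of a flag in standard form -/

/-- The label of the last coordinate of a vector with a given name. -/
def StdVec.lead : StdVec → ℤ
  | .basis j => j
  | .hatOne i => -i
  | .hatTwo _ j => -j

/-- The hat vectors of the form `ê_a` or `ê_{a,-j}`. -/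
def StdVec.IsHat (a : ℤ) : StdVec → Prop
  | .basis _ => False
  | .hatOne i => i = a
  | .hatTwo i _ => i = a

lemma StdVec.basis_or_isHat (x : StdVec) : (∃ j, x = .basis j) ∨ ∃ a, x.IsHat a := by
  cases x <;> simp [IsHat]

lemma StdVec.IsHat.lead_eq {x : StdVec} {a : ℤ} (h : x.IsHat a) : x.lead = -x.index := by
  cases x <;> simp [IsHat, lead, index] at *

lemma StdVec.abs_lead {ℓ : ℕ} {x : StdVec} (h : x.Valid ℓ) : |x.lead| = x.index := by
  cases x <;> simp only [lead, index, Valid, abs_neg] at * <;> exact abs_of_pos (by omega)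

lemma e_mid {ℓ : ℕ} {j : ℤ} (hj : j ≠ 0) : e ℓ j (mid ℓ) = 0 := by
  simp [e, coordLabel_mid, hj.symm]

lemma hat_mid {ℓ : ℕ} {i : ℤ} (hi : i ≠ 0) : hat ℓ i (mid ℓ) = ((Real.sqrt 2 : ℝ) : ℂ) := by
  simp [hat, e, coordLabel_mid, hi, hi.symm]

lemma sqrt_two_ne_zero : ((Real.sqrt 2 : ℝ) : ℂ) ≠ 0 := by
  simp

lemma sqrt_two_mul_self : ((Real.sqrt 2 : ℝ) : ℂ) * ((Real.sqrt 2 : ℝ) : ℂ) = 2 := by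
  norm_cast
  simp

lemma StdVec.IsHat.toVec_mid {ℓ : ℕ} {x : StdVec} {a : ℤ} (h : x.IsHat a) (hx : x.Valid ℓ) :
    x.toVec ℓ (mid ℓ) = ((Real.sqrt 2 : ℝ) : ℂ) := by
  cases x with
  | basis j => exact h.elim
  | hatOne i => exact hat_mid (by simp only [Valid] at hx; omega)
  | hatTwo i j =>
    simp only [Valid] at hx
    simp only [toVec, Pi.add_apply]
    rw [hat_mid (by omega), e_mid (by omega), add_zero]

lemma StdVec.hasLead {ℓ : ℕ} {x : StdVec} (hx : x.Valid ℓ) {k : Fin (2 * ℓ + 1)}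
    (hk : coordLabel ℓ k = x.lead) : HasLead (x.toVec ℓ) k := by
  cases x with
  | basis j =>
    simp only [lead] at hk
    refine ⟨by simp [toVec, e, hk], fun i hi => ?_⟩
    have : coordLabel ℓ i ≠ j := fun h => hi.ne' (coordLabel_injective ℓ (h.trans hk.symm))
    simp [toVec, e, this]
  | hatOne a =>
    simp only [lead, Valid] at hk hx
    refine ⟨?_, fun i hi => ?_⟩
    · have h1 : -a ≠ a := by omega
      have h2 : -a ≠ 0 := by omega
      simp only [toVec, hat, e, hk, Pi.sub_apply, Pi.add_apply, Pi.smul_apply, if_neg h1, if_neg h2]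
      simp
    · have := coordLabel_lt_of_lt hi (by omega)
      have h1 : coordLabel ℓ i ≠ a := by omega
      have h2 : coordLabel ℓ i ≠ 0 := by omega
      have h3 : coordLabel ℓ i ≠ -a := by omega
      simp [toVec, hat, e, h1, h2, h3]
  | hatTwo a j =>
    simp only [lead, Valid] at hk hx
    refine ⟨?_, fun i hi => ?_⟩
    · have h1 : -j ≠ a := by omega
      have h2 : -j ≠ 0 := by omega
      have h3 : -j ≠ -a := by omega
      simp only [toVec, hat, e, hk, Pi.sub_apply, Pi.add_apply, Pi.smul_apply, if_neg h1,
        if_neg h2, if_neg h3]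
      simp
    · have := coordLabel_lt_of_lt hi (by omega)
      have h1 : coordLabel ℓ i ≠ a := by omega
      have h2 : coordLabel ℓ i ≠ 0 := by omega
      have h3 : coordLabel ℓ i ≠ -a := by omega
      have h4 : coordLabel ℓ i ≠ -j := by omega
      simp [toVec, hat, e, h1, h2, h3, h4]

/-! ### Products of hat vectors and basis vectors -/

lemma form_hat_e {ℓ : ℕ} (i : ℤ) {j : ℤ} (h1 : -(ℓ : ℤ) ≤ j) (h2 : j ≤ ℓ) (hj : j ≠ 0) :
    form (hat ℓ i) (e ℓ j) = (if i = -j then 1 else 0) - (if i = j then 1 else 0) := by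
  have h3 : (0 : ℤ) ≠ -j := by omega
  simp only [hat, form_add_left, form_sub_left, form_smul_left, form_e_e _ h1 h2, neg_inj,
    if_neg h3, mul_zero, add_zero]

/-- The `e 0`-parts contribute √2·√2 = 2; for i = j the two cross terms of e_i with −e_{-i}
contribute −2. -/
lemma form_hat_hat {ℓ : ℕ} {i j : ℤ} (hi : 1 ≤ i) (hj : 1 ≤ j) (h2 : j ≤ ℓ) :
    form (hat ℓ i) (hat ℓ j) = 2 - (if i = j then 2 else 0) := by
  have h3 : i ≠ -j := by omega
  rw [show hat ℓ j = e ℓ j + ((Real.sqrt 2 : ℝ) : ℂ) • e ℓ 0 - e ℓ (-j) from rfl]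
  rw [form_sub_right, form_add_right, form_smul_right, form_hat_e i (by omega) h2 (by omega),
    form_hat_e i (j := -j) (by omega) (by omega) (by omega), form_e_zero, hat_mid (by omega),
    sqrt_two_mul_self, neg_neg, if_neg h3]
  split_ifs <;> norm_num

/-- Hat vectors with different `a` are not orthogonal. -/
lemma StdVec.IsHat.eq_of_form_eq_zero {ℓ : ℕ} {x y : StdVec} {a b : ℤ} (hx : x.IsHat a)
    (hy : y.IsHat b) (hxv : x.Valid ℓ) (hyv : y.Valid ℓ)
    (h : form (x.toVec ℓ) (y.toVec ℓ) = 0) : a = b := by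
  -- For a ≠ b the product is 2 plus a term 0 or 1 for each possible coincidence of a second-kind
  -- index with the other parameter, so it cannot vanish.
  by_contra hab
  cases x with
  | basis j => exact hx
  | hatOne i =>
    obtain rfl : i = a := hx
    cases y with
    | basis j => exact hy
    | hatOne i' =>
      obtain rfl : i' = b := hy
      simp only [Valid, toVec] at *
      rw [form_hat_hat (by omega) (by omega) (by omega), if_neg hab] at h
      norm_num at h
    | hatTwo i' j' =>
      obtain rfl : i' = b := hy
      simp only [Valid, toVec] at *
      have h1 : i ≠ -j' := by omega
      rw [form_add_right, form_hat_hat (by omega) (by omega) (by omega), if_neg hab,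
        form_hat_e _ (by omega) (by omega) (by omega), neg_neg, if_neg h1] at h
      split_ifs at h <;> norm_num at h
  | hatTwo i j =>
    obtain rfl : i = a := hx
    cases y with
    | basis j => exact hy
    | hatOne i' =>
      obtain rfl : i' = b := hy
      simp only [Valid, toVec] at *
      have h1 : i' ≠ -j := by omega
      rw [form_add_left, form_hat_hat (by omega) (by omega) (by omega), if_neg hab, form_comm,
        form_hat_e _ (by omega) (by omega) (by omega), neg_neg, if_neg h1] at h
      split_ifs at h <;> norm_num at h
    | hatTwo i' j' =>
      obtain rfl : i' = b := hy
      simp only [Valid, toVec] at *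
      have h1 : i' ≠ -j := by omega
      have h2 : i ≠ -j' := by omega
      have h3 : -j ≠ - -j' := by omega
      rw [form_add_left, form_add_right, form_add_right, form_hat_hat (by omega) (by omega)
        (by omega), if_neg hab, form_comm (e ℓ (-j)) (hat ℓ i'),
        form_hat_e _ (by omega) (by omega) (by omega),
        form_hat_e _ (by omega) (by omega) (by omega),
        form_e_e _ (by omega) (by omega), neg_neg, neg_neg, if_neg h1, if_neg h2] at h
      rw [neg_neg] at h3
      rw [if_neg h3] at h
      split_ifs at h <;> norm_num at h

/-- A hat vector `ê_a` or `ê_{a,-j}` is not orthogonal to `e_a` and `e_{-a}`. -/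
lemma StdVec.IsHat.form_basis_ne_zero {ℓ : ℕ} {x : StdVec} {a c : ℤ} (hx : x.IsHat a)
    (hxv : x.Valid ℓ) (hc : |c| = a) : form (x.toVec ℓ) (e ℓ c) ≠ 0 := by
  replace hc := eq_or_eq_neg_of_abs_eq hc
  cases x with
  | basis j => exact hx.elim
  | hatOne i =>
    obtain rfl : i = a := hx
    simp only [Valid, toVec] at *
    rw [form_hat_e _ (by omega) (by omega) (by omega)]
    split_ifs <;> first | omega | norm_num
  | hatTwo i j =>
    obtain rfl : i = a := hx
    simp only [Valid, toVec] at *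
    have h1 : -j ≠ -c := by omega
    rw [form_add_left, form_hat_e _ (by omega) (by omega) (by omega),
      form_e_e _ (by omega) (by omega), if_neg h1]
    split_ifs <;> first | omega | norm_num

/-! ### Sequences in standard form -/

section StdSeq

variable {ℓ : ℕ} {v : Fin ℓ → StdVec}

/-- Pigeonhole: the ℓ values 1, …, ℓ are taken at distinct positions, which exhausts the ℓ
positions. -/
lemma IsStdSeq.index_mem (hv : IsStdSeq ℓ v) (i : Fin ℓ) :
    1 ≤ (v i).index ∧ (v i).index ≤ ℓ := by
  have h : ∀ m : Fin ℓ, ∃ i, (v i).index = (m : ℤ) + 1 := fun m =>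
    (hv.index_unique (m + 1) (by omega) (by omega)).exists
  choose g hg using h
  have hinj : Function.Injective g := by
    intro m m' h
    have h1 := hg m
    rw [h, hg m'] at h1
    ext
    omega
  obtain ⟨m, rfl⟩ := Finite.surjective_of_injective hinj i
  rw [hg m]
  omega

lemma IsStdSeq.index_injective (hv : IsStdSeq ℓ v) :
    Function.Injective fun i => (v i).index := fun i _ h =>
  (hv.index_unique _ (hv.index_mem i).1 (hv.index_mem i).2).unique rfl h.symm

lemma IsStdSeq.exists_lead (hv : IsStdSeq ℓ v) :
    ∃ κ : Fin ℓ → Fin (2 * ℓ + 1), Function.Injective κ ∧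
      ∀ i, coordLabel ℓ (κ i) = (v i).lead ∧ HasLead ((v i).toVec ℓ) (κ i) := by
  have h : ∀ i, ∃ k, coordLabel ℓ k = (v i).lead := fun i => by
    have h1 := StdVec.abs_lead (hv.valid i)
    have h2 := hv.index_mem i
    rw [← h1] at h2
    exact exists_coordLabel_eq (abs_le.mp h2.2).1 (abs_le.mp h2.2).2
  choose κ hκ using h
  refine ⟨κ, fun i i' h => hv.index_injective ?_, fun i => ⟨hκ i, (v i).hasLead (hv.valid i) (hκ i)⟩⟩
  have h1 := hκ i
  rw [h, hκ i'] at h1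
  simp only [← StdVec.abs_lead (hv.valid _), h1]

/-- The vectors of the sequence are pairwise orthogonal and isotropic. -/
def IsotropicSeq (ℓ : ℕ) (v : Fin ℓ → StdVec) : Prop :=
  ∀ i j, form ((v i).toVec ℓ) ((v j).toVec ℓ) = 0

lemma IsStdSeq.isHat_eq (hv : IsStdSeq ℓ v) (hi : IsotropicSeq ℓ v) {i k : Fin ℓ} {a b : ℤ}
    (h : (v i).IsHat a) (h' : (v k).IsHat b) : a = b :=
  h.eq_of_form_eq_zero h' (hv.valid i) (hv.valid k) (hi i k)

/-- Some vector has index a. It is not e_a or e_{-a}, which are not orthogonal to the given hat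
vector, nor some ê_{b,-a}, since then b = a by isotropy while validity requires a < b. -/
lemma IsStdSeq.exists_hatOne (hv : IsStdSeq ℓ v) (hi : IsotropicSeq ℓ v) {i : Fin ℓ} {a : ℤ}
    (h : (v i).IsHat a) : ∃ k, v k = .hatOne a := by
  have ha : 1 ≤ a ∧ a ≤ ℓ := by
    have h1 := hv.valid i
    cases hvi : v i with
    | basis j => rw [hvi] at h; exact h.elim
    | hatOne b =>
      rw [hvi] at h h1
      obtain rfl : b = a := h
      exact h1
    | hatTwo b j =>
      rw [hvi] at h h1
      obtain rfl : b = a := h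
      simp only [StdVec.Valid] at h1
      omega
  obtain ⟨k, hk, -⟩ := hv.index_unique a ha.1 ha.2
  refine ⟨k, ?_⟩
  cases hvk : v k with
  | basis j =>
    rw [hvk] at hk
    refine absurd (hi i k) ?_
    rw [hvk]
    exact h.form_basis_ne_zero (hv.valid i) hk
  | hatOne b => 
    rw [hvk] at hk
    rw [show b = a from hk]
  | hatTwo b j =>
    rw [hvk] at hk
    have h1 : a = b := hv.isHat_eq hi h (k := k) (b := b) (by rw [hvk]; rfl)
    have h2 := hv.valid k
    rw [hvk] at h2
    simp only [StdVec.Valid, StdVec.index] at h2 hk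
    omega

/-- With a common parameter a, second-kind indices increase by (b) and are below a, and by (a) no
hat vector follows ê_a. -/
lemma IsStdSeq.index_lt_of_isHat (hv : IsStdSeq ℓ v) (hi : IsotropicSeq ℓ v) {i k : Fin ℓ}
    {a b : ℤ} (h : (v i).IsHat a) (h' : (v k).IsHat b) (hik : i < k) :
    (v i).index < (v k).index := by
  obtain rfl := hv.isHat_eq hi h h'
  cases hvi : v i with
  | basis j => rw [hvi] at h; exact h.elim
  | hatOne b =>
    obtain ⟨j, hj⟩ := hv.after_hatOne i b hvi k hik
    rw [hj] at h'
    exact h'.elim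
  | hatTwo b j =>
    rw [hvi] at h
    obtain rfl : b = a := h
    cases hvk : v k with
    | basis j => rw [hvk] at h'; exact h'.elim
    | hatOne c =>
      rw [hvk] at h'
      obtain rfl : c = b := h'
      have h2 := hv.valid i
      rw [hvi] at h2
      exact h2.2.1
    | hatTwo c j' =>
      rw [hvk] at h'
      obtain rfl : c = b := h'
      exact hv.hatTwo_lt i k hik _ _ _ hvi hvk

/-- A hat vector is the last vector among those of its flag whose lead does not occur in `e_0^⊥`. -/
lemma IsStdSeq.not_hasLead_of_isHat (hv : IsStdSeq ℓ v) (hi : IsotropicSeq ℓ v) {i : Fin ℓ}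
    {a : ℤ} (h : (v i).IsHat a) {k : Fin (2 * ℓ + 1)} (hk : coordLabel ℓ k = (v i).lead)
    {x : Vec (2 * ℓ + 1)}
    (hx : x ∈ Submodule.span ℂ ((fun i => (v i).toVec ℓ) '' Set.Iic i))
    (hx0 : x (mid ℓ) = 0) : ¬HasLead x k := by
  intro hxk
  obtain ⟨κ, hκ, hlead⟩ := hv.exists_lead
  obtain ⟨c, rfl⟩ := exists_sum_of_mem_span_image_Iic hx
  obtain ⟨m, hm, hcm, hm1, hm2⟩ := exists_hasLead_sum hκ (fun i => (hlead i).2) (Finset.Iic i) c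
    (by
      by_contra! h
      refine hxk.1 ?_
      rw [Finset.sum_eq_zero fun m hm => by rw [h m hm, zero_smul]]
      rfl)
  have h1 : κ m = κ i := (hm1.unique hxk).trans (coordLabel_injective ℓ (hk.trans (hlead i).1.symm))
  obtain rfl := hκ h1
  rw [Finset.sum_apply, Finset.sum_eq_single m] at hx0
  · rw [Pi.smul_apply, h.toVec_mid (hv.valid m), smul_eq_mul] at hx0
    exact mul_ne_zero hcm sqrt_two_ne_zero hx0
  · intro p hp hpm
    have hlt : p < m := lt_of_le_of_ne (Finset.mem_Iic.mp hp) hpm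
    rcases (v p).basis_or_isHat with ⟨j, hj⟩ | ⟨b, hb⟩
    · have := (hv.index_mem p).1
      rw [hj] at this ⊢
      rw [Pi.smul_apply, StdVec.toVec, e_mid, smul_zero]
      rintro rfl
      simp [StdVec.index] at this
    · by_cases hc : c p = 0
      · simp [hc]
      -- An earlier hat vector has smaller index, so its lead, labelled by minus the index, is at a
      -- later coordinate; a non-zero coefficient would push the lead of the sum beyond `κ m`.
      · have h2 := hm2 p hp hc
        have h3 := hv.index_lt_of_isHat hi hb h hlt
        have h4 := hv.index_mem p
        refine absurd h2 (not_le.mpr (lt_of_coordLabel_lt (ℓ := ℓ) ?_ ?_)) <;>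
          simp only [(hlead _).1, hb.lead_eq, h.lead_eq] <;> omega
  · simp

end StdSeq

/-! ### Uniqueness of the standard form in an orbit -/

/-- The image of v_i keeps its lead, which must be the lead of some v'_m with m ≤ i. For m < i it
would by induction also be the lead of v_m, contradicting distinctness. -/
lemma lead_eq_of_borelMap {ℓ : ℕ} {v v' : Fin ℓ → StdVec} (hv : IsStdSeq ℓ v)
    (hv' : IsStdSeq ℓ v') {f : Vec (2 * ℓ + 1) →ₗ[ℂ] Vec (2 * ℓ + 1)} (hf : IsBorelMap ℓ f)
    (h : ∀ i, (Submodule.span ℂ ((fun i => (v i).toVec ℓ) '' Set.Iic i)).map f =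
      Submodule.span ℂ ((fun i => (v' i).toVec ℓ) '' Set.Iic i)) (i : Fin ℓ) :
    (v i).lead = (v' i).lead := by
  obtain ⟨κ, hκ, hlead⟩ := hv.exists_lead
  obtain ⟨κ', hκ', hlead'⟩ := hv'.exists_lead
  suffices hh : κ i = κ' i by rw [← (hlead i).1, ← (hlead' i).1, hh]
  induction i using WellFoundedLT.induction with
  | ind i ih =>
  have h1 : f ((v i).toVec ℓ) ∈ Submodule.span ℂ ((fun i => (v' i).toVec ℓ) '' Set.Iic i) := by
    rw [← h i]
    exact Submodule.mem_map_of_mem (Submodule.subset_span ⟨i, Set.self_mem_Iic, rfl⟩)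
  obtain ⟨c, hc⟩ := exists_sum_of_mem_span_image_Iic h1
  have h2 := hf.hasLead (hlead i).2
  rw [hc] at h2
  obtain ⟨m, hm, -, hm1, -⟩ := exists_hasLead_sum hκ' (fun i => (hlead' i).2) (Finset.Iic i) c
    (by
      by_contra! h
      refine h2.1 ?_
      rw [Finset.sum_eq_zero fun m hm => by rw [h m hm, zero_smul]]
      rfl)
  have h3 := h2.unique hm1
  rcases (Finset.mem_Iic.mp hm).lt_or_eq with hlt | rfl
  · exact absurd (hκ (h3.trans (ih m hlt).symm)) hlt.ne'
  · exact h3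

/-- If v'_i were a hat vector, the image of v_i would have the same lead and `e 0`-coordinate 0,
which `IsStdSeq.not_hasLead_of_isHat` forbids. -/
lemma basis_of_borelMap {ℓ : ℕ} {v v' : Fin ℓ → StdVec} (hv : IsStdSeq ℓ v)
    (hv' : IsStdSeq ℓ v') (hi' : IsotropicSeq ℓ v')
    {f : Vec (2 * ℓ + 1) →ₗ[ℂ] Vec (2 * ℓ + 1)} (hf : IsBorelMap ℓ f)
    (h : ∀ i, (Submodule.span ℂ ((fun i => (v i).toVec ℓ) '' Set.Iic i)).map f =
      Submodule.span ℂ ((fun i => (v' i).toVec ℓ) '' Set.Iic i)) {i : Fin ℓ} {j : ℤ}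
    (hj : v i = .basis j) : v' i = .basis j := by
  have hl := lead_eq_of_borelMap hv hv' hf h i
  obtain ⟨κ, hκ, hlead⟩ := hv.exists_lead
  rcases (v' i).basis_or_isHat with ⟨j', hj'⟩ | ⟨a, ha⟩
  · rw [hj, hj'] at hl
    rw [hj', show j = j' from hl]
  · exfalso
    have h1 : f ((v i).toVec ℓ) ∈
        Submodule.span ℂ ((fun i => (v' i).toVec ℓ) '' Set.Iic i) := by
      rw [← h i]
      exact Submodule.mem_map_of_mem (Submodule.subset_span ⟨i, Set.self_mem_Iic, rfl⟩)
    refine hv'.not_hasLead_of_isHat hi' ha ((hlead i).1.trans hl) h1 ?_ (hf.hasLead (hlead i).2)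
    have := (hv.index_mem i).1
    rw [hf.apply_mid]
    rw [hj] at this ⊢
    refine e_mid ?_
    rintro rfl
    simp [StdVec.index] at this

/-- Two sequences in standard form whose flags lie in the same orbit are equal. -/
lemma stdSeq_eq_of_borelMap {ℓ : ℕ} {v v' : Fin ℓ → StdVec} (hv : IsStdSeq ℓ v)
    (hv' : IsStdSeq ℓ v') (hi : IsotropicSeq ℓ v) (hi' : IsotropicSeq ℓ v')
    {f g : Vec (2 * ℓ + 1) →ₗ[ℂ] Vec (2 * ℓ + 1)} (hf : IsBorelMap ℓ f) (hg : IsBorelMap ℓ g)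
    (h : ∀ i, (Submodule.span ℂ ((fun i => (v i).toVec ℓ) '' Set.Iic i)).map f =
      Submodule.span ℂ ((fun i => (v' i).toVec ℓ) '' Set.Iic i))
    (h' : ∀ i, (Submodule.span ℂ ((fun i => (v' i).toVec ℓ) '' Set.Iic i)).map g =
      Submodule.span ℂ ((fun i => (v i).toVec ℓ) '' Set.Iic i)) : v = v' := by
  have hlead := lead_eq_of_borelMap hv hv' hf h
  have hindex : ∀ i, (v i).index = (v' i).index := fun i => by
    rw [← StdVec.abs_lead (hv.valid i), hlead, StdVec.abs_lead (hv'.valid i)]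
  have hbasis : ∀ i j, v i = .basis j → v' i = .basis j := fun i j =>
    basis_of_borelMap hv hv' hi' hf h
  have hbasis' : ∀ i j, v' i = .basis j → v i = .basis j := fun i j =>
    basis_of_borelMap hv' hv hi hg h'
  -- a hat vector of the first kind has the largest index among the hat vectors
  have hle : ∀ {w : Fin ℓ → StdVec}, IsStdSeq ℓ w → IsotropicSeq ℓ w → ∀ {i k : Fin ℓ} {a b : ℤ},
      (w i).IsHat a → (w k).IsHat b → (w k).index ≤ a := by
    intro w hw hiw i k a b ha hb
    obtain rfl := hw.isHat_eq hiw ha hb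
    have := hw.valid k
    cases hwk : w k with
    | basis j => rw [hwk] at hb; exact hb.elim
    | hatOne c => rw [hwk] at hb; exact le_of_eq hb
    | hatTwo c j =>
      rw [hwk] at hb this
      obtain rfl : c = a := hb
      exact this.2.1.le
  -- Where w has ê_a, the sequence w' also has a hat vector; its index is a, hence a is at most the
  -- parameter b of w'.
  have hhat : ∀ {w w' : Fin ℓ → StdVec}, IsStdSeq ℓ w → IsStdSeq ℓ w' → IsotropicSeq ℓ w →
      IsotropicSeq ℓ w' → (∀ i, (w i).index = (w' i).index) →
      (∀ i j, w' i = .basis j → w i = .basis j) →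
      ∀ {i : Fin ℓ} {a b : ℤ}, (w i).IsHat a → (w' i).IsHat b → a ≤ b := by
    intro w w' hw hw' hiw hiw' hidx hb' i a b ha hb
    obtain ⟨k, hk⟩ := hw.exists_hatOne hiw ha
    rcases (w' k).basis_or_isHat with ⟨j, hj⟩ | ⟨c, hc⟩
    · have := hb' k j hj
      rw [hk] at this
      cases this
    · have h1 := hle hw' hiw' hb hc
      rw [← hidx, hk] at h1
      exact h1
  funext i
  rcases (v i).basis_or_isHat with ⟨j, hj⟩ | ⟨a, ha⟩
  · rw [hj, hbasis i j hj]
  rcases (v' i).basis_or_isHat with ⟨j, hj⟩ | ⟨b, hb⟩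
  · rw [hj, hbasis' i j hj]
  have hab : a = b := le_antisymm (hhat hv hv' hi hi' hindex hbasis' ha hb)
    (hhat hv' hv hi' hi (fun i => (hindex i).symm) hbasis hb ha)
  subst hab
  have hidx := hindex i
  have hval := hv.valid i
  have hval' := hv'.valid i
  -- With a common parameter a, a hat vector is determined by its index: the first kind has index a,
  -- the second kind a smaller one.
  revert ha hb hidx hval hval'
  cases v i <;> cases v' i <;>
    simp only [StdVec.IsHat, StdVec.index, StdVec.Valid, false_imp_iff, imp_true_iff,
      StdVec.hatOne.injEq, StdVec.hatTwo.injEq, reduceCtorEq] <;> intros <;> omega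

/-! ### Splitting off the hyperbolic plane of `e_1` and `e_{-1}` -/

/-- The vector `p e_1 + y + r e_{-1}` of `ℂ^(2ℓ+3)`, where `y` is a vector of `ℂ^(2ℓ+1)` with its
coordinates moved by one place. -/
def blk {ℓ : ℕ} (p : ℂ) (y : Vec (2 * ℓ + 1)) (r : ℂ) : Vec (2 * (ℓ + 1) + 1) :=
  (Fin.cons p (Fin.snoc y r : Fin (2 * ℓ + 1 + 1) → ℂ) : Fin (2 * ℓ + 1 + 1 + 1) → ℂ)

/-- The position in `ℂ^(2ℓ+3)` of a coordinate of `ℂ^(2ℓ+1)`. -/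
def inner {ℓ : ℕ} (k : Fin (2 * ℓ + 1)) : Fin (2 * (ℓ + 1) + 1) := ⟨k + 1, by omega⟩

section Blocks

variable {ℓ : ℕ}

lemma blk_first (p : ℂ) (y : Vec (2 * ℓ + 1)) (r : ℂ) : blk p y r 0 = p := rfl

lemma blk_last (p : ℂ) (y : Vec (2 * ℓ + 1)) (r : ℂ) : blk p y r (Fin.last _) = r := by
  change (Fin.cons p (Fin.snoc y r : Fin (2 * ℓ + 1 + 1) → ℂ) : Fin (2 * ℓ + 1 + 1 + 1) → ℂ)
    (Fin.last (2 * ℓ + 1)).succ = r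
  rw [Fin.cons_succ, Fin.snoc_last]

lemma blk_inner (p : ℂ) (y : Vec (2 * ℓ + 1)) (r : ℂ) (k : Fin (2 * ℓ + 1)) :
    blk p y r (inner k) = y k := by
  change (Fin.cons p (Fin.snoc y r : Fin (2 * ℓ + 1 + 1) → ℂ) : Fin (2 * ℓ + 1 + 1 + 1) → ℂ)
    k.castSucc.succ = y k
  rw [Fin.cons_succ, Fin.snoc_castSucc]

lemma coord_cases {P : Fin (2 * (ℓ + 1) + 1) → Prop} (h0 : P 0) (hl : P (Fin.last _))
    (hi : ∀ k, P (inner k)) (k : Fin (2 * (ℓ + 1) + 1)) : P k := by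
  obtain ⟨k, hk⟩ := k
  rcases Nat.eq_zero_or_pos k with rfl | h
  · exact h0
  rcases Nat.lt_or_ge k (2 * ℓ + 2) with h' | h'
  · have := hi ⟨k - 1, by omega⟩
    simp only [inner] at this
    convert this using 2
    omega
  · convert hl using 1
    ext
    simp only [Fin.val_last]
    omega

lemma exists_blk (x : Vec (2 * (ℓ + 1) + 1)) : ∃ p y r, x = blk (ℓ := ℓ) p y r := by
  refine ⟨x 0, fun k => x (inner k), x (Fin.last _), funext ?_⟩
  refine coord_cases ?_ ?_ ?_
  · rw [blk_first]
  · rw [blk_last]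
  · intro k
    rw [blk_inner]

lemma blk_inj {p p' r r' : ℂ} {y y' : Vec (2 * ℓ + 1)} :
    blk p y r = blk p' y' r' ↔ p = p' ∧ y = y' ∧ r = r' := by
  refine ⟨fun h => ⟨?_, funext fun k => ?_, ?_⟩, by rintro ⟨rfl, rfl, rfl⟩; rfl⟩
  · simpa [blk_first] using congrFun h 0
  · simpa [blk_inner] using congrFun h (inner k)
  · simpa [blk_last] using congrFun h (Fin.last _)

lemma blk_add (p p' r r' : ℂ) (y y' : Vec (2 * ℓ + 1)) :
    blk p y r + blk p' y' r' = blk (p + p') (y + y') (r + r') := by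
  refine funext (coord_cases ?_ ?_ fun k => ?_) <;>
    simp only [Pi.add_apply, blk_first, blk_last, blk_inner]

lemma blk_sub (p p' r r' : ℂ) (y y' : Vec (2 * ℓ + 1)) :
    blk p y r - blk p' y' r' = blk (p - p') (y - y') (r - r') := by
  refine funext (coord_cases ?_ ?_ fun k => ?_) <;>
    simp only [Pi.sub_apply, blk_first, blk_last, blk_inner]

lemma blk_smul (c p r : ℂ) (y : Vec (2 * ℓ + 1)) :
    c • blk p y r = blk (c * p) (c • y) (c * r) := by
  refine funext (coord_cases ?_ ?_ fun k => ?_) <;>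
    simp only [Pi.smul_apply, blk_first, blk_last, blk_inner, smul_eq_mul]

lemma blk_zero : blk (ℓ := ℓ) 0 0 0 = 0 := by
  refine funext (coord_cases ?_ ?_ fun k => ?_) <;>
    simp only [Pi.zero_apply, blk_first, blk_last, blk_inner]

/-- The embedding of the middle block. -/
def blkL (ℓ : ℕ) : Vec (2 * ℓ + 1) →ₗ[ℂ] Vec (2 * (ℓ + 1) + 1) where
  toFun y := blk 0 y 0
  map_add' y y' := by simp [blk_add]
  map_smul' c y := by simp [blk_smul]

/-- The projection to the middle block. -/
def innerL (ℓ : ℕ) : Vec (2 * (ℓ + 1) + 1) →ₗ[ℂ] Vec (2 * ℓ + 1) where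
  toFun x := fun k => x (inner k)
  map_add' _ _ := rfl
  map_smul' _ _ := rfl

lemma innerL_blk (p r : ℂ) (y : Vec (2 * ℓ + 1)) : innerL ℓ (blk p y r) = y :=
  funext fun k => blk_inner p y r k

lemma form_blk (p p' r r' : ℂ) (y y' : Vec (2 * ℓ + 1)) :
    form (blk p y r) (blk p' y' r') = p * r' + form y y' + r * p' := by
  have h0 : Fin.rev (0 : Fin (2 * (ℓ + 1) + 1)) = Fin.last _ := by simp
  have hr : ∀ k : Fin (2 * ℓ + 1), Fin.rev (inner k) = inner (Fin.rev k) := by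
    intro k
    ext
    simp only [Fin.val_rev, inner]
    omega
  rw [form_eq_sum, form_eq_sum]
  have h1 := Fin.sum_univ_succ (n := 2 * ℓ + 1 + 1)
    (fun i => blk p y r i * blk p' y' r' (Fin.rev (n := 2 * (ℓ + 1) + 1) i))
  refine h1.trans ?_
  rw [Fin.sum_univ_castSucc (n := 2 * ℓ + 1), add_assoc (p * r')]
  refine congrArg₂ (· + ·) ?_ (congrArg₂ (· + ·) ?_ ?_)
  · change blk p y r 0 * blk p' y' r' (Fin.rev 0) = _
    rw [h0, blk_first, blk_last]
  · refine Finset.sum_congr rfl fun k _ => ?_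
    change blk p y r (inner k) * blk p' y' r' (Fin.rev (inner k)) = _
    rw [hr, blk_inner, blk_inner]
  · change blk p y r (Fin.last _) * blk p' y' r' (Fin.rev (Fin.last _)) = _
    rw [← h0, Fin.rev_rev, h0, blk_first, blk_last]

lemma coordLabel_first : coordLabel (ℓ + 1) 0 = 1 := by
  simp [coordLabel]

lemma coordLabel_last : coordLabel (ℓ + 1) (Fin.last _) = -1 := by
  simp only [coordLabel, Fin.val_last]
  split_ifs <;> push_cast <;> omega

/-- The label in `ℂ^(2ℓ+3)` of the coordinate of `ℂ^(2ℓ+1)` with label `j`. -/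
def shiftLabel (j : ℤ) : ℤ := if 0 < j then j + 1 else if j = 0 then 0 else j - 1

lemma coordLabel_inner (k : Fin (2 * ℓ + 1)) :
    coordLabel (ℓ + 1) (inner k) = shiftLabel (coordLabel ℓ k) := by
  have := k.2
  simp only [coordLabel, inner, shiftLabel]
  split_ifs <;> push_cast <;> omega

lemma shiftLabel_inj {i j : ℤ} : shiftLabel i = shiftLabel j ↔ i = j := by
  unfold shiftLabel
  split_ifs <;> omega

lemma e_one : e (ℓ + 1) 1 = blk 1 0 0 := by
  refine funext (coord_cases ?_ ?_ fun k => ?_)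
  · simp [e, coordLabel_first, blk_first]
  · simp [e, coordLabel_last, blk_last]
  · rw [blk_inner]
    have : coordLabel (ℓ + 1) (inner k) ≠ 1 := by
      rw [coordLabel_inner]
      unfold shiftLabel
      split_ifs <;> omega
    simp [e, this]

lemma e_neg_one : e (ℓ + 1) (-1) = blk 0 0 1 := by
  refine funext (coord_cases ?_ ?_ fun k => ?_)
  · simp [e, coordLabel_first, blk_first]
  · simp [e, coordLabel_last, blk_last]
  · rw [blk_inner]
    have : coordLabel (ℓ + 1) (inner k) ≠ -1 := by
      rw [coordLabel_inner]
      unfold shiftLabel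
      split_ifs <;> omega
    simp [e, this]

lemma e_shiftLabel (j : ℤ) : e (ℓ + 1) (shiftLabel j) = blk 0 (e ℓ j) 0 := by
  have h1 : 1 ≠ shiftLabel j := by unfold shiftLabel; split_ifs <;> omega
  have h2 : -1 ≠ shiftLabel j := by unfold shiftLabel; split_ifs <;> omega
  refine funext (coord_cases ?_ ?_ fun k => ?_)
  · simp [e, coordLabel_first, blk_first, h1]
  · simp [e, coordLabel_last, blk_last, h2]
  · rw [blk_inner]
    simp [e, coordLabel_inner, shiftLabel_inj]

lemma e_zero_eq_blk : e (ℓ + 1) 0 = blk 0 (e ℓ 0) 0 := by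
  rw [← e_shiftLabel]
  simp [shiftLabel]

lemma hat_add_one {i : ℤ} (hi : 0 < i) : hat (ℓ + 1) (i + 1) = blk 0 (hat ℓ i) 0 := by
  have h1 : shiftLabel i = i + 1 := by simp [shiftLabel, hi]
  have h2 : shiftLabel (-i) = -(i + 1) := by
    unfold shiftLabel
    split_ifs <;> omega
  rw [hat, hat, ← h1, e_shiftLabel, h1, ← h2, e_shiftLabel, e_zero_eq_blk]
  simp only [blk_smul, blk_add, blk_sub, mul_zero, add_zero, sub_zero]

lemma hat_one : hat (ℓ + 1) 1 = blk 1 (((Real.sqrt 2 : ℝ) : ℂ) • e ℓ 0) (-1) := by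
  rw [hat, e_one, e_neg_one, e_zero_eq_blk]
  simp only [blk_smul, blk_add, blk_sub, mul_zero, add_zero, sub_zero, zero_add, zero_sub]

/-! ### Borel maps adapted to the blocks -/

lemma inner_lt_inner {k m : Fin (2 * ℓ + 1)} : inner k < inner m ↔ k < m := by
  simp only [inner, Fin.lt_def]
  omega

/-- The proper initial coordinate subspaces are the line of e_1 and its sums with initial subspaces
of the middle block; the whole space imposes nothing. -/
lemma triangular_of_blk {f : Vec (2 * (ℓ + 1) + 1) →ₗ[ℂ] Vec (2 * (ℓ + 1) + 1)}
    (h0 : ∀ p, ∃ p', f (blk p 0 0) = blk p' 0 0)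
    (h1 : ∀ m p y, (∀ i, m < i → y i = 0) →
      ∃ p' y', f (blk p y 0) = blk p' y' 0 ∧ ∀ i, m < i → y' i = 0) :
    ∀ k x, (∀ i, k < i → x i = 0) → ∀ i, k < i → f x i = 0 := by
  have hlast : ∀ m : Fin (2 * ℓ + 1), inner m < Fin.last (2 * (ℓ + 1)) := fun m => by
    simp only [inner, Fin.lt_def, Fin.val_last]
    omega
  refine coord_cases ?_ ?_ ?_
  · intro x hx i hi
    obtain ⟨p, y, r, rfl⟩ := exists_blk x
    have hr : r = 0 := by
      rw [← hx (Fin.last _) (Fin.last_pos' ), blk_last]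
    have hy : y = 0 := funext fun k => by
      rw [← blk_inner p y r k, hx _ (by simp [inner, Fin.lt_def])]
      rfl
    subst hr hy
    obtain ⟨p', hp'⟩ := h0 p
    rw [hp']
    induction i using coord_cases with
    | h0 => exact absurd hi (lt_irrefl _)
    | hl => exact blk_last _ _ _
    | hi k =>
      rw [blk_inner]
      rfl
  · exact fun x _ i hi => absurd hi (not_lt.mpr (Fin.le_last i))
  · intro m x hx i hi
    obtain ⟨p, y, r, rfl⟩ := exists_blk x
    have hr : r = 0 := by
      rw [← hx (Fin.last _) (hlast m), blk_last]
    subst hr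
    obtain ⟨p', y', hy', hm⟩ := h1 m p y fun i hi => by
      rw [← blk_inner p y 0 i, hx _ (inner_lt_inner.mpr hi)]
    rw [hy']
    induction i using coord_cases with
    | h0 => exact absurd hi (Fin.not_lt_zero _)
    | hl => exact blk_last _ _ _
    | hi k =>
      rw [blk_inner]
      exact hm k (inner_lt_inner.mp hi)

/-- The map which is `g` on the middle block and multiplies `e_1` and `e_{-1}` by `t` and `t⁻¹`. -/
def diagMap (t : ℂ) (g : Vec (2 * ℓ + 1) →ₗ[ℂ] Vec (2 * ℓ + 1)) :
    Vec (2 * (ℓ + 1) + 1) →ₗ[ℂ] Vec (2 * (ℓ + 1) + 1) where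
  toFun x := blk (t * x 0) (g (innerL ℓ x)) (t⁻¹ * x (Fin.last _))
  map_add' x y := by simp [blk_add, mul_add]
  map_smul' c x := by simp [blk_smul, mul_left_comm]

lemma diagMap_blk (t : ℂ) (g : Vec (2 * ℓ + 1) →ₗ[ℂ] Vec (2 * ℓ + 1)) (p r : ℂ)
    (y : Vec (2 * ℓ + 1)) : diagMap t g (blk p y r) = blk (t * p) (g y) (t⁻¹ * r) := by
  change blk (t * blk p y r 0) (g (innerL ℓ (blk p y r))) (t⁻¹ * blk p y r (Fin.last _)) = _
  rw [blk_first, blk_last, innerL_blk]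

lemma isBorelMap_diagMap {t : ℂ} (ht : t ≠ 0) {g : Vec (2 * ℓ + 1) →ₗ[ℂ] Vec (2 * ℓ + 1)}
    (hg : IsBorelMap ℓ g) : IsBorelMap (ℓ + 1) (diagMap t g) where
  isometry x x' := by
    obtain ⟨p, y, r, rfl⟩ := exists_blk x
    obtain ⟨p', y', r', rfl⟩ := exists_blk x'
    rw [diagMap_blk, diagMap_blk, form_blk, form_blk, hg.isometry]
    field_simp
  map_e_zero := by
    rw [e_zero_eq_blk, diagMap_blk, hg.map_e_zero, mul_zero, mul_zero]
  triangular := by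
    refine triangular_of_blk (fun p => ⟨t * p, ?_⟩) fun m p y hy => ⟨t * p, g y, ?_, ?_⟩
    · rw [diagMap_blk, map_zero, mul_zero]
    · rw [diagMap_blk, mul_zero]
    · exact hg.triangular m y hy

/-- The unipotent map attached to a vector `w` of the middle block. -/
def unipMap (w : Vec (2 * ℓ + 1)) : Vec (2 * (ℓ + 1) + 1) →ₗ[ℂ] Vec (2 * (ℓ + 1) + 1) where
  -- Once e_{-1} is translated by w, the first correction preserves its products with the middle
  -- block, and the term β(w,w)/2 keeps its image isotropic.
  toFun x := blk (x 0 - form (innerL ℓ x) w - x (Fin.last _) * (form w w / 2))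
    (innerL ℓ x + x (Fin.last _) • w) (x (Fin.last _))
  map_add' x y := by
    rw [blk_add, blk_inj]
    refine ⟨?_, ?_, rfl⟩
    · simp only [map_add, form_add_left, Pi.add_apply]
      ring
    · simp only [map_add, Pi.add_apply, add_smul]
      abel
  map_smul' c x := by
    simp only [RingHom.id_apply]
    rw [blk_smul, blk_inj]
    refine ⟨?_, ?_, rfl⟩
    · simp only [map_smul, form_smul_left, Pi.smul_apply, smul_eq_mul]
      ring
    · simp only [map_smul, Pi.smul_apply, smul_add, smul_smul, smul_eq_mul]

lemma unipMap_blk (w : Vec (2 * ℓ + 1)) (p r : ℂ) (y : Vec (2 * ℓ + 1)) :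
    unipMap w (blk p y r) = blk (p - form y w - r * (form w w / 2)) (y + r • w) r := by
  change blk (blk p y r 0 - form (innerL ℓ (blk p y r)) w -
    blk p y r (Fin.last _) * (form w w / 2))
    (innerL ℓ (blk p y r) + blk p y r (Fin.last _) • w) (blk p y r (Fin.last _)) = _
  rw [blk_first, blk_last, innerL_blk]

/-- The condition on w says that it is orthogonal to e_0; otherwise the image of e_0 would acquire
an e_1-component. -/
lemma isBorelMap_unipMap {w : Vec (2 * ℓ + 1)} (hw : w (mid ℓ) = 0) :
    IsBorelMap (ℓ + 1) (unipMap w) where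
  isometry x x' := by
    obtain ⟨p, y, r, rfl⟩ := exists_blk x
    obtain ⟨p', y', r', rfl⟩ := exists_blk x'
    rw [unipMap_blk, unipMap_blk, form_blk, form_blk, form_add_left, form_add_right,
      form_add_right, form_smul_left, form_smul_left, form_smul_right, form_smul_right,
      form_comm w y']
    ring
  map_e_zero := by
    rw [e_zero_eq_blk, unipMap_blk, form_comm, form_e_zero, hw]
    simp
  triangular := by
    refine triangular_of_blk (fun p => ⟨p, ?_⟩) fun m p y hy => ⟨p - form y w, y, ?_, hy⟩
    · rw [unipMap_blk, form_zero_left]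
      simp
    · rw [unipMap_blk]
      simp

end Blocks

/-! ### Chains of spans -/

/-- The span of the members of a family up to a given one. -/
def spanIic {n l : ℕ} (u : Fin l → Vec n) (i : Fin l) : Submodule ℂ (Vec n) :=
  Submodule.span ℂ (u '' Set.Iic i)

section SpanIic

variable {n l : ℕ}

lemma mem_spanIic {u : Fin l → Vec n} {i m : Fin l} (h : m ≤ i) : u m ∈ spanIic u i :=
  Submodule.subset_span ⟨m, h, rfl⟩

lemma spanIic_mono (u : Fin l → Vec n) : Monotone (spanIic u) := fun _ _ h =>
  Submodule.span_mono (Set.image_mono (Set.Iic_subset_Iic.mpr h))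

lemma spanIic_le {u : Fin l → Vec n} {i : Fin l} {U : Submodule ℂ (Vec n)}
    (h : ∀ m ≤ i, u m ∈ U) : spanIic u i ≤ U := by
  refine Submodule.span_le.mpr ?_
  rintro _ ⟨m, hm, rfl⟩
  exact h m hm

lemma spanIic_congr {u u' : Fin l → Vec n} (h : ∀ m, u m ∈ spanIic u' m)
    (h' : ∀ m, u' m ∈ spanIic u m) : spanIic u = spanIic u' :=
  funext fun _ => le_antisymm (spanIic_le fun m hm => spanIic_mono u' hm (h m))
    (spanIic_le fun m hm => spanIic_mono u hm (h' m))

lemma map_spanIic {n' : ℕ} (f : Vec n →ₗ[ℂ] Vec n') (u : Fin l → Vec n) (i : Fin l) :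
    (spanIic u i).map f = spanIic (fun m => f (u m)) i := by
  rw [spanIic, spanIic, Submodule.map_span, Set.image_image]

lemma finrank_spanIic {u : Fin l → Vec n} (hu : LinearIndependent ℂ u) (i : Fin l) :
    Module.finrank ℂ (spanIic u i) = i + 1 := by
  have h := finrank_span_set_eq_card (R := ℂ) (s := u '' Set.Iic i)
    (by
      have := hu.linearIndepOn_id.mono (Set.image_subset_range u (Set.Iic i))
      exact this)
  rw [spanIic, h, Set.toFinset_image, Finset.card_image_of_injective _ hu.injective]
  simp

/-- Inserting a vector into equivalent chains; the inserted vector matters only up to a scalar and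
up to the vectors which precede it. -/
lemma spanIic_insertNth_congr (q : Fin (l + 1)) {a a' : Vec n} {y y' : Fin l → Vec n}
    (hy : spanIic y = spanIic y') {c : ℂ} (hc : c ≠ 0)
    (ha : a - c • a' ∈ Submodule.span ℂ (y '' {m | q.succAbove m < q})) :
    spanIic (q.insertNth a y : Fin (l + 1) → Vec n) = spanIic (q.insertNth a' y') := by
  have key : ∀ {y y' : Fin l → Vec n} (a a' : Vec n), spanIic y = spanIic y' →
      ∀ m, y m ∈ spanIic (q.insertNth a' y' : Fin (l + 1) → Vec n) (q.succAbove m) := by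
    intro y y' a a' hy m
    have h1 : y m ∈ spanIic y' m := hy ▸ mem_spanIic le_rfl
    refine spanIic_le (fun p hp => ?_) h1
    have h2 := mem_spanIic (u := (q.insertNth a' y' : Fin (l + 1) → Vec n))
      ((Fin.strictMono_succAbove q).monotone hp)
    rwa [Fin.insertNth_apply_succAbove] at h2
  have hle : ∀ {y y' : Fin l → Vec n} (a' : Vec n), spanIic y = spanIic y' →
      Submodule.span ℂ (y '' {m | q.succAbove m < q}) ≤
        spanIic (q.insertNth a' y' : Fin (l + 1) → Vec n) q := by
    intro y y' a' hy
    refine Submodule.span_le.mpr ?_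
    rintro _ ⟨m, hm, rfl⟩
    exact spanIic_mono _ (le_of_lt hm) (key a' a' hy m)
  have hself : ∀ (b : Vec n) (z : Fin l → Vec n),
      b ∈ spanIic (q.insertNth b z : Fin (l + 1) → Vec n) q := by
    intro b z
    have := mem_spanIic (u := (q.insertNth b z : Fin (l + 1) → Vec n)) (le_refl q)
    rwa [Fin.insertNth_apply_same] at this
  refine spanIic_congr (fun m => ?_) fun m => ?_
  · induction m using Fin.succAboveCases q with
    | x =>
      rw [Fin.insertNth_apply_same]
      have := add_mem (hle a' hy ha) (Submodule.smul_mem _ c (hself a' y'))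
      rwa [sub_add_cancel] at this
    | p m =>
      rw [Fin.insertNth_apply_succAbove]
      exact key a a' hy m
  · induction m using Fin.succAboveCases q with
    | x =>
      rw [Fin.insertNth_apply_same]
      have := Submodule.smul_mem _ c⁻¹ (sub_mem (hself a y) (hle a rfl ha))
      rwa [sub_sub_cancel, smul_smul, inv_mul_cancel₀ hc, one_smul] at this
    | p m =>
      rw [Fin.insertNth_apply_succAbove]
      exact key a' a hy.symm m

end SpanIic

/-! ### Bases adapted to a flag -/

namespace IsoFlag

variable {ℓ : ℕ} (F : IsoFlag ℓ)

/-- The member of the flag preceding `V i`, which is `0` for the first one. -/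
def prev (i : Fin ℓ) : Submodule ℂ (Vec (2 * ℓ + 1)) :=
  if (i : ℕ) = 0 then ⊥ else F.V ⟨i - 1, by omega⟩

lemma le_prev {i j : Fin ℓ} (h : j < i) : F.V j ≤ F.prev i := by
  have h' : (j : ℕ) < i := h
  rw [prev, if_neg (by omega)]
  exact F.mono (by rw [Fin.le_def]; simp only; omega)

lemma prev_le (i : Fin ℓ) {U : Submodule ℂ (Vec (2 * ℓ + 1))} (h : ∀ j < i, F.V j ≤ U) :
    F.prev i ≤ U := by
  unfold prev
  split_ifs with hi
  · exact bot_le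
  · exact h _ (by rw [Fin.lt_def]; simp only; omega)

lemma exists_notMem_prev (i : Fin ℓ) : ∃ x ∈ F.V i, x ∉ F.prev i := by
  by_contra! h
  have h1 := Submodule.finrank_mono (show F.V i ≤ F.prev i from h)
  rw [F.finrank_eq] at h1
  by_cases hi : (i : ℕ) = 0
  · rw [show F.prev i = ⊥ from if_pos hi, finrank_bot] at h1
    omega
  · rw [show F.prev i = _ from if_neg hi, F.finrank_eq] at h1
    simp only at h1
    omega

lemma linearIndependent_of_notMem_prev {x : Fin ℓ → Vec (2 * ℓ + 1)}
    (hx : ∀ i, x i ∈ F.V i) (hx' : ∀ i, x i ∉ F.prev i) : LinearIndependent ℂ x := by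
  rw [linearIndependent_iff']
  intro s c hs
  by_contra! h
  obtain ⟨m, hm, hmax⟩ := (s.filter fun i => c i ≠ 0).exists_max_image _root_.id
    (by obtain ⟨i, hi, h⟩ := h; exact ⟨i, by simp [hi, h]⟩)
  rw [Finset.mem_filter] at hm
  rw [← Finset.add_sum_erase s _ hm.1] at hs
  have h1 : ∑ i ∈ s.erase m, c i • x i ∈ F.prev m := by
    refine Submodule.sum_mem _ fun i hi => ?_
    rw [Finset.mem_erase] at hi
    by_cases hc : c i = 0
    · simp [hc]
    · have hle : i ≤ m := hmax i (by simp [hi.2, hc])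
      exact Submodule.smul_mem _ _ (F.le_prev (lt_of_le_of_ne hle hi.1) (hx i))
  have h2 : c m • x m ∈ F.prev m := by
    rw [eq_neg_of_add_eq_zero_left hs]
    exact neg_mem h1
  refine hx' m ?_
  have h3 := Submodule.smul_mem _ (c m)⁻¹ h2
  rwa [smul_smul, inv_mul_cancel₀ hm.2, one_smul] at h3

lemma eq_spanIic_of_notMem_prev {x : Fin ℓ → Vec (2 * ℓ + 1)}
    (hx : ∀ i, x i ∈ F.V i) (hx' : ∀ i, x i ∉ F.prev i) : F.V = spanIic x := by
  funext i
  refine (Submodule.eq_of_le_of_finrank_eq (spanIic_le fun m hm => F.mono hm (hx m)) ?_).symm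
  rw [finrank_spanIic (F.linearIndependent_of_notMem_prev hx hx'), F.finrank_eq]

/-- The flag of a linearly independent family of pairwise orthogonal isotropic vectors. -/
def ofFamily (x : Fin ℓ → Vec (2 * ℓ + 1)) (hx : LinearIndependent ℂ x)
    (hi : ∀ i j, form (x i) (x j) = 0) : IsoFlag ℓ where
  V := spanIic x
  mono := spanIic_mono x
  finrank_eq := finrank_spanIic hx
  isotropic i := form_eq_zero_of_mem_span (by
    rintro _ ⟨m, -, rfl⟩ _ ⟨m', -, rfl⟩
    exact hi m m')

end IsoFlag

/-- A maximal isotropic subspace orthogonal to `e_1` contains it. -/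
lemma IsoFlag.e_one_mem {ℓ : ℕ} (F : IsoFlag (ℓ + 1))
    (h : ∀ x ∈ F.V (Fin.last ℓ), x (Fin.last _) = 0) : blk 1 0 0 ∈ F.V (Fin.last ℓ) := by
  by_contra hmem
  have hform : ∀ x : Vec (2 * (ℓ + 1) + 1), form x (blk 1 0 0) = x (Fin.last _) := by
    intro x
    obtain ⟨p, y, r, rfl⟩ := exists_blk x
    rw [form_blk, form_zero_right, blk_last]
    simp
  -- Adjoining e_1 would give an isotropic space of dimension at least ℓ + 2, whereas 2(ℓ + 2) > 2ℓ
  -- + 3.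
  have h1 := two_mul_finrank_le_of_isotropic
    (Submodule.span ℂ (insert (blk 1 0 0) (F.V (Fin.last ℓ) : Set (Vec (2 * (ℓ + 1) + 1)))))
    (form_eq_zero_of_mem_span (by
      rintro u (rfl | hu) w (rfl | hw)
      · rw [hform, blk_last]
      · rw [form_comm, hform, h w hw]
      · rw [hform, h u hu]
      · exact F.isotropic _ u hu w hw))
  have h2 := Submodule.finrank_lt_finrank_of_lt
    (show F.V (Fin.last ℓ) <
      Submodule.span ℂ (insert (blk 1 0 0) (F.V (Fin.last ℓ) : Set (Vec (2 * (ℓ + 1) + 1)))) from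
      lt_of_le_of_ne (fun x hx => Submodule.subset_span (Set.mem_insert_of_mem _ hx))
        (fun heq => hmem (heq ▸ Submodule.subset_span (Set.mem_insert _ _))))
  rw [F.finrank_eq] at h2
  simp only [Fin.val_last] at h2
  omega

/-- A basis adapted to a flag all of whose members but one are orthogonal to `e_1`. -/
lemma IsoFlag.exists_adapted {ℓ : ℕ} (F : IsoFlag (ℓ + 1)) :
    ∃ (q : Fin (ℓ + 1)) (x : Fin (ℓ + 1) → Vec (2 * (ℓ + 1) + 1)),
      LinearIndependent ℂ x ∧ F.V = spanIic x ∧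
      (∀ m, x (q.succAbove m) (Fin.last _) = 0) ∧
      (x q = blk 1 0 0 ∨ x q (Fin.last _) = 1) := by
  choose z hz hz' using F.exists_notMem_prev
  by_cases h : ∀ x ∈ F.V (Fin.last ℓ), x (Fin.last _) = 0
  -- Here q is the first place where e_1 enters the flag, so e_1 can serve as the q-th basis vector.
  · obtain ⟨q, hq, hmin⟩ := WellFounded.has_min (wellFounded_lt (α := Fin (ℓ + 1)))
      {i | blk 1 0 0 ∈ F.V i} ⟨_, F.e_one_mem h⟩
    have hprev : blk 1 0 0 ∉ F.prev q := by
      unfold prev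
      split_ifs with h0
      · rw [Submodule.mem_bot, ← blk_zero, blk_inj]
        simp
      · exact fun hmem => hmin _ hmem (by rw [Fin.lt_def]; simp only; omega)
    have hx : ∀ i, Function.update z q (blk 1 0 0) i ∈ F.V i := fun i => by
      rcases eq_or_ne i q with rfl | hi
      · rwa [Function.update_self]
      · rw [Function.update_of_ne hi]
        exact hz i
    have hx' : ∀ i, Function.update z q (blk 1 0 0) i ∉ F.prev i := fun i => by
      rcases eq_or_ne i q with rfl | hi
      · rwa [Function.update_self]
      · rw [Function.update_of_ne hi]
        exact hz' i
    refine ⟨q, Function.update z q (blk 1 0 0), F.linearIndependent_of_notMem_prev hx hx',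
      F.eq_spanIic_of_notMem_prev hx hx', fun m => ?_, Or.inl (Function.update_self _ _ _)⟩
    rw [Function.update_of_ne (Fin.succAbove_ne q m)]
    exact h _ (F.mono (Fin.le_last _) (hz _))
  · push Not at h
    -- Here q is the first place where the flag is not orthogonal to e_1.
    obtain ⟨q, ⟨u, hu, hu0⟩, hmin⟩ := WellFounded.has_min (wellFounded_lt (α := Fin (ℓ + 1)))
      {i | ∃ x ∈ F.V i, x (Fin.last _) ≠ 0} ⟨_, h⟩
    have hlt : ∀ j < q, ∀ x ∈ F.V j, x (Fin.last _) = 0 := fun j hj x hx => by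
      by_contra h0
      exact hmin j ⟨x, hx, h0⟩ hj
    set a : Vec (2 * (ℓ + 1) + 1) := (u (Fin.last _))⁻¹ • u with ha
    have ha1 : a (Fin.last _) = 1 := by
      rw [ha, Pi.smul_apply, smul_eq_mul, inv_mul_cancel₀ hu0]
    have haq : a ∈ F.V q := Submodule.smul_mem _ _ hu
    have hprev : a ∉ F.prev q := by
      have : F.prev q ≤ LinearMap.ker (LinearMap.proj (R := ℂ) (φ := fun _ => ℂ)
          (Fin.last (2 * (ℓ + 1)))) :=
        F.prev_le q fun j hj x hx => hlt j hj x hx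
      intro hmem
      have h0 : a (Fin.last _) = 0 := this hmem
      rw [h0] at ha1
      exact zero_ne_one ha1
    -- Subtracting multiples of a kills the last coordinates. Before q the multiple is 0 and after q
    -- the vector a already lies in the flag, so the basis stays adapted.
    let x : Fin (ℓ + 1) → Vec (2 * (ℓ + 1) + 1) := fun i =>
      if i = q then a else z i - (z i (Fin.last _)) • a
    have hxq : x q = a := if_pos rfl
    have hxne : ∀ i, i ≠ q → x i = z i - (z i (Fin.last _)) • a := fun i hi => if_neg hi
    have hmem : ∀ i, i ≠ q → z i (Fin.last _) • a ∈ F.prev i := fun i hi => by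
      rcases lt_or_gt_of_ne hi with h1 | h1
      · rw [hlt i h1 _ (hz i), zero_smul]
        exact zero_mem _
      · exact Submodule.smul_mem _ _ (F.le_prev h1 haq)
    have hx : ∀ i, x i ∈ F.V i := fun i => by
      rcases eq_or_ne i q with rfl | hi
      · rwa [hxq]
      · rw [hxne i hi]
        exact sub_mem (hz i) (F.prev_le i (fun j hj => F.mono hj.le) (hmem i hi))
    have hx' : ∀ i, x i ∉ F.prev i := fun i => by
      rcases eq_or_ne i q with rfl | hi
      · rwa [hxq]
      · rw [hxne i hi]
        intro h1
        have h2 := add_mem h1 (hmem i hi)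
        rw [sub_add_cancel] at h2
        exact hz' i h2
    refine ⟨q, x, F.linearIndependent_of_notMem_prev hx hx', F.eq_spanIic_of_notMem_prev hx hx',
      fun m => ?_, Or.inr (by rw [hxq, ha1])⟩
    rw [hxne _ (Fin.succAbove_ne q m), Pi.sub_apply, Pi.smul_apply, ha1, smul_eq_mul, mul_one,
      sub_self]

/-- A vector orthogonal to `e_0` with prescribed products with an isotropic family. -/
lemma exists_form_eq {ℓ l : ℕ} {y : Fin l → Vec (2 * ℓ + 1)} (hy : LinearIndependent ℂ y)
    (hi : ∀ i j, form (y i) (y j) = 0) (p : Fin l → ℂ) :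
    ∃ w : Vec (2 * ℓ + 1), w (mid ℓ) = 0 ∧ ∀ i, form (y i) w = p i := by
  -- As β(e_0, e_0) = 1, e_0 lies outside the isotropic span of y. A functional can thus be 0 on e_0
  -- and p_i on y_i; the vector w represents it through the form.
  have hli : LinearIndependent ℂ (Fin.cons (e ℓ 0) y : Fin (l + 1) → Vec (2 * ℓ + 1)) := by
    refine linearIndependent_finCons.mpr ⟨hy, fun hmem => ?_⟩
    have h := form_eq_zero_of_mem_span (s := Set.range y)
      (by rintro _ ⟨m, rfl⟩ _ ⟨m', rfl⟩; exact hi m m') _ hmem _ hmem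
    rw [form_e_zero] at h
    simp [e, coordLabel_mid] at h
  obtain ⟨φ, hφ⟩ := LinearMap.exists_extend
    ((Module.Basis.span hli).constr ℂ (Fin.cons 0 p : Fin (l + 1) → ℂ))
  have hφ' : ∀ i, φ ((Fin.cons (e ℓ 0) y : Fin (l + 1) → Vec (2 * ℓ + 1)) i) =
      (Fin.cons 0 p : Fin (l + 1) → ℂ) i := by
    intro i
    have h1 := LinearMap.congr_fun hφ (Module.Basis.span hli i)
    rw [Module.Basis.constr_basis, LinearMap.comp_apply, Submodule.subtype_apply,
      Module.Basis.span_apply] at h1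
    exact h1
  have hw : ∀ x, form x (fun k => φ (Pi.single (Fin.rev k) 1)) = φ x := by
    intro x
    rw [form_eq_sum, LinearMap.pi_apply_eq_sum_univ φ x]
    refine Finset.sum_congr rfl fun i _ => ?_
    rw [Fin.rev_rev, smul_eq_mul]
    congr 2
    funext k
    simp [Pi.single_apply, eq_comm]
  refine ⟨fun k => φ (Pi.single (Fin.rev k) 1), ?_, fun i => ?_⟩
  · change φ (Pi.single (Fin.rev (mid ℓ)) 1) = 0
    rw [rev_mid, ← e_zero]
    exact hφ' 0
  · rw [hw]
    exact hφ' i.succ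

/-! ### Lengthening sequences in standard form -/

/-- Raise all indices by one. -/
def StdVec.shift : StdVec → StdVec
  | .basis j => .basis (shiftLabel j)
  | .hatOne i => .hatOne (i + 1)
  | .hatTwo i j => .hatTwo (i + 1) (j + 1)

lemma StdVec.shift_valid {ℓ : ℕ} {x : StdVec} (hx : x.Valid ℓ) : x.shift.Valid (ℓ + 1) := by
  cases x <;> simp only [Valid, shift, shiftLabel] at * <;> push_cast <;> (try split_ifs) <;> omega

lemma StdVec.shift_index {x : StdVec} (hx : 1 ≤ x.index) : x.shift.index = x.index + 1 := by
  cases x with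
  | basis j =>
    simp only [index, shift, shiftLabel] at *
    split_ifs with h1 h2
    · rw [abs_of_pos h1, abs_of_pos (by omega)]
    · simp [h2] at hx
    · rw [abs_of_neg (by omega), abs_of_neg (by omega)]
      ring
  | hatOne i => rfl
  | hatTwo i j => rfl

lemma StdVec.toVec_shift {ℓ : ℕ} {x : StdVec} (hx : x.Valid ℓ) :
    x.shift.toVec (ℓ + 1) = blk 0 (x.toVec ℓ) 0 := by
  cases x with
  | basis j => exact e_shiftLabel j
  | hatOne i =>
    simp only [Valid] at hx
    exact hat_add_one (by omega)
  | hatTwo i j =>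
    simp only [Valid] at hx
    have h2 : -(j + 1) = shiftLabel (-j) := by
      unfold shiftLabel
      split_ifs <;> omega
    simp only [shift, toVec]
    rw [hat_add_one (by omega), h2, e_shiftLabel, blk_add, add_zero]

/-- The sequence with indices raised by one and a new vector inserted in place `q`. -/
def insertSeq {ℓ : ℕ} (q : Fin (ℓ + 1)) (x : StdVec) (v : Fin ℓ → StdVec) :
    Fin (ℓ + 1) → StdVec :=
  q.insertNth (α := fun _ => StdVec) x fun m => (v m).shift

section InsertSeq

variable {ℓ : ℕ} (q : Fin (ℓ + 1)) (x : StdVec) (v : Fin ℓ → StdVec)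

lemma insertSeq_same : insertSeq q x v q = x := Fin.insertNth_apply_same (α := fun _ => StdVec) q x _

lemma insertSeq_succAbove (m : Fin ℓ) : insertSeq q x v (q.succAbove m) = (v m).shift :=
  Fin.insertNth_apply_succAbove (α := fun _ => StdVec) q x _ m

lemma toVec_insertSeq {v : Fin ℓ → StdVec} (hv : ∀ m, (v m).Valid ℓ) :
    (fun i => (insertSeq q x v i).toVec (ℓ + 1)) =
      q.insertNth (α := fun _ => Vec (2 * (ℓ + 1) + 1)) (x.toVec (ℓ + 1))
        fun m => blk 0 ((v m).toVec ℓ) 0 := by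
  funext i
  induction i using Fin.succAboveCases q with
  | x => rw [insertSeq_same, Fin.insertNth_apply_same]
  | p m => rw [insertSeq_succAbove, Fin.insertNth_apply_succAbove, StdVec.toVec_shift (hv m)]

variable {q x v}

/-- The new index 1 is below all shifted indices, so condition (b) is safe if a new hat vector
precedes the old ones, and then it also never follows an old first-kind vector. A new first-kind
vector is only inserted when no other hat vector is present. -/
lemma isStdSeq_insertSeq (hv : IsStdSeq ℓ v) (hx : x.Valid (ℓ + 1)) (hx1 : x.index = 1)
    (hone : ∀ a, x = .hatOne a → ∀ m, ∃ j, v m = .basis j)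
    (hhat : (∃ j, x = .basis j) ∨ ∀ m a, (v m).IsHat a → q < q.succAbove m) :
    IsStdSeq (ℓ + 1) (insertSeq q x v) where
  valid i := by
    induction i using Fin.succAboveCases q with
    | x => rwa [insertSeq_same]
    | p m =>
      rw [insertSeq_succAbove]
      exact StdVec.shift_valid (hv.valid m)
  after_hatOne i a hi k hk := by
    induction i using Fin.succAboveCases q with
    | x =>
      rw [insertSeq_same] at hi
      induction k using Fin.succAboveCases q with
      | x => exact absurd hk (lt_irrefl _)
      | p m =>
        obtain ⟨j, hj⟩ := hone a hi m
        rw [insertSeq_succAbove, hj]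
        exact ⟨_, rfl⟩
    | p m =>
      rw [insertSeq_succAbove] at hi
      have hm : v m = .hatOne (a - 1) := by
        cases hvm : v m <;> rw [hvm] at hi <;> simp only [StdVec.shift, reduceCtorEq,
          StdVec.hatOne.injEq] at hi ⊢
        omega
      induction k using Fin.succAboveCases q with
      | x =>
        rw [insertSeq_same]
        rcases hhat with h | h
        · exact h
        · exact absurd hk (h m (a - 1) (by rw [hm]; rfl)).not_gt
      | p m' =>
        obtain ⟨j, hj⟩ := hv.after_hatOne m _ hm m' ((Fin.strictMono_succAbove q).lt_iff_lt.mp hk)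
        rw [insertSeq_succAbove, hj]
        exact ⟨_, rfl⟩
  hatTwo_lt i k hik a j j' hi hk := by
    have hshift : ∀ {m b c}, insertSeq q x v (q.succAbove m) = .hatTwo b c →
        v m = .hatTwo (b - 1) (c - 1) := by
      intro m b c hm
      rw [insertSeq_succAbove] at hm
      cases hvm : v m <;> rw [hvm] at hm <;> simp only [StdVec.shift, reduceCtorEq,
          StdVec.hatTwo.injEq] at hm ⊢
      omega
    induction i using Fin.succAboveCases q with
    | x =>
      rw [insertSeq_same] at hi
      induction k using Fin.succAboveCases q with
      | x => exact absurd hik (lt_irrefl _)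
      | p m =>
        have h1 := hv.valid m
        rw [hshift hk] at h1
        rw [hi] at hx1
        simp only [StdVec.Valid, StdVec.index] at h1 hx1
        omega
    | p m =>
      replace hi := hshift hi
      induction k using Fin.succAboveCases q with
      | x =>
        rw [insertSeq_same] at hk
        rcases hhat with ⟨c, hc⟩ | h
        · rw [hk] at hc
          cases hc
        · exact absurd hik (h m (a - 1) (by rw [hi]; rfl)).not_gt
      | p m' =>
        have := hv.hatTwo_lt m m' ((Fin.strictMono_succAbove q).lt_iff_lt.mp hik) _ _ _ hi
          (hshift hk)
        omega
  index_unique n hn1 hn2 := by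
    have hidx : ∀ m, (insertSeq q x v (q.succAbove m)).index = (v m).index + 1 := fun m => by
      rw [insertSeq_succAbove, StdVec.shift_index (hv.index_mem m).1]
    rcases hn1.eq_or_lt with rfl | hn
    · refine ⟨q, by simp only [insertSeq_same, hx1], fun i hi => ?_⟩
      induction i using Fin.succAboveCases q with
      | x => rfl
      | p m =>
        have := hidx m
        have := (hv.index_mem m).1
        omega
    · obtain ⟨m, hm, huniq⟩ := hv.index_unique (n - 1) (by omega) (by push_cast at hn2; omega)
      refine ⟨q.succAbove m, ?_, fun i hi => ?_⟩
      · exact (hidx m).trans (by omega)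
      · induction i using Fin.succAboveCases q with
        | x =>
          simp only [insertSeq_same] at hi
          omega
        | p m' =>
          rw [huniq m']
          have := hidx m'
          simp only at hi ⊢
          omega

end InsertSeq

/-! ### Every orbit contains a flag in standard form -/

lemma form_blk_zero {ℓ : ℕ} (y y' : Vec (2 * ℓ + 1)) :
    form (blk 0 y 0) (blk 0 y' 0) = form y y' := by
  rw [form_blk]
  ring

/-- A flag whose intersection with `e_1^⊥` is in standard form modulo `e_1` can be brought into
standard form. -/
lemma exists_std_of_inner {ℓ : ℕ} {v : Fin ℓ → StdVec} (hv : IsStdSeq ℓ v)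
    (hi : IsotropicSeq ℓ v) (q : Fin (ℓ + 1)) {p : ℂ} {y : Vec (2 * ℓ + 1)}
    (hy : ∀ m, form y ((v m).toVec ℓ) = 0) (hyy : 2 * p + form y y = 0) :
    ∃ f, IsBorelMap (ℓ + 1) f ∧ ∃ x : StdVec, IsStdSeq (ℓ + 1) (insertSeq q x v) ∧
      (fun i => (spanIic (q.insertNth (α := fun _ => Vec (2 * (ℓ + 1) + 1)) (blk p y 1)
        fun m => blk 0 ((v m).toVec ℓ) 0) i).map f) =
        spanIic fun i => (insertSeq q x v i).toVec (ℓ + 1) := by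
  -- it suffices to move the inserted vector
  have key : ∀ {f : Vec (2 * (ℓ + 1) + 1) →ₗ[ℂ] Vec (2 * (ℓ + 1) + 1)} {x : StdVec} {c : ℂ},
      IsBorelMap (ℓ + 1) f → IsStdSeq (ℓ + 1) (insertSeq q x v) →
      (∀ m, f (blk 0 ((v m).toVec ℓ) 0) = blk 0 ((v m).toVec ℓ) 0) → c ≠ 0 →
      f (blk p y 1) - c • x.toVec (ℓ + 1) ∈
        Submodule.span ℂ ((fun m => blk 0 ((v m).toVec ℓ) 0) '' {m | q.succAbove m < q}) →
      ∃ f, IsBorelMap (ℓ + 1) f ∧ ∃ x : StdVec, IsStdSeq (ℓ + 1) (insertSeq q x v) ∧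
      (fun i => (spanIic (q.insertNth (α := fun _ => Vec (2 * (ℓ + 1) + 1)) (blk p y 1)
        fun m => blk 0 ((v m).toVec ℓ) 0) i).map f) =
        spanIic fun i => (insertSeq q x v i).toVec (ℓ + 1) := by
    intro f x c hf hx hfix hc hmem
    refine ⟨f, hf, x, hx, ?_⟩
    rw [toVec_insertSeq q x hv.valid, ← spanIic_insertNth_congr q rfl hc hmem]
    funext i
    rw [map_spanIic]
    congr 1
    funext m
    induction m using Fin.succAboveCases q with
    | x => rw [Fin.insertNth_apply_same, Fin.insertNth_apply_same]
    | p m => rw [Fin.insertNth_apply_succAbove, Fin.insertNth_apply_succAbove, hfix]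
  have key_eq : ∀ {f : Vec (2 * (ℓ + 1) + 1) →ₗ[ℂ] Vec (2 * (ℓ + 1) + 1)} {x : StdVec} {c : ℂ},
      IsBorelMap (ℓ + 1) f → IsStdSeq (ℓ + 1) (insertSeq q x v) →
      (∀ m, f (blk 0 ((v m).toVec ℓ) 0) = blk 0 ((v m).toVec ℓ) 0) → c ≠ 0 →
      f (blk p y 1) = c • x.toVec (ℓ + 1) → _ :=
    fun hf hx hfix hc h => key hf hx hfix hc (by rw [h, sub_self]; exact zero_mem _)
  have hbasis : ∀ {m j}, v m = .basis j → j ≠ 0 := by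
    rintro m j hm rfl
    have := (hv.index_mem m).1
    rw [hm] at this
    simp [StdVec.index] at this
  have hneg : IsStdSeq (ℓ + 1) (insertSeq q (.basis (-1)) v) := by
    refine isStdSeq_insertSeq hv ?_ rfl (fun a ha => by cases ha) (Or.inl ⟨_, rfl⟩)
    simp only [StdVec.Valid]
    push_cast
    omega
  have hunip : ∀ {w : Vec (2 * ℓ + 1)}, (∀ m, form ((v m).toVec ℓ) w = 0) →
      ∀ m, unipMap w (blk 0 ((v m).toVec ℓ) 0) = blk 0 ((v m).toVec ℓ) 0 := by
    intro w hw m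
    rw [unipMap_blk, hw]
    simp
  by_cases hhat : ∃ m a, (v m).IsHat a
  · -- the inserted vector becomes a multiple of a hat vector plus `e_{-1}`
    have hmove : ∀ {m a}, (v m).IsHat a → ∃ κ : ℂ, ∃ w : Vec (2 * ℓ + 1), w (mid ℓ) = 0 ∧
        (∀ m, form ((v m).toVec ℓ) w = 0) ∧
        unipMap w (blk p y 1) = blk 0 (κ • (v m).toVec ℓ) 1 := by
      intro m a hm
      have hmid := hm.toVec_mid (hv.valid m)
      -- This κ gives κ v_m the same `e 0`-coordinate as y, so the difference is an admissible w for
      -- `unipMap`.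
      set κ : ℂ := y (mid ℓ) / ((Real.sqrt 2 : ℝ) : ℂ) with hκ
      refine ⟨κ, κ • (v m).toVec ℓ - y, ?_, fun m' => ?_, ?_⟩
      · rw [Pi.sub_apply, Pi.smul_apply, hmid, hκ, smul_eq_mul, div_mul_cancel₀ _ sqrt_two_ne_zero,
          sub_self]
      · rw [form_sub_right, form_smul_right, hi, form_comm, hy]
        ring
      · rw [unipMap_blk, blk_inj]
        refine ⟨?_, ?_, rfl⟩
        · have h1 := hi m m
          have h2 := hy m
          simp only [form_sub_left, form_sub_right, form_smul_left, form_smul_right, h1, h2,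
            form_comm _ y]
          -- The new e_1-component is p + β(y,y)/2, which vanishes because the inserted vector is
          -- isotropic.
          linear_combination (1 / 2 : ℂ) * hyy
        · rw [one_smul, add_sub_cancel]
    -- If a hat vector precedes place q, its multiple can be subtracted without changing the flag,
    -- which leaves e_{-1}. Otherwise ê_a is used, and the hat vector created at q precedes all
    -- others.
    by_cases hbefore : ∃ m a, (v m).IsHat a ∧ q.succAbove m < q
    · obtain ⟨m, a, hm, hmq⟩ := hbefore
      obtain ⟨κ, w, hw0, hw, hκ⟩ := hmove hm
      refine key (isBorelMap_unipMap hw0) hneg (hunip hw) one_ne_zero ?_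
      rw [hκ, StdVec.toVec, e_neg_one, one_smul, blk_sub, sub_zero, sub_zero, sub_self]
      have := Submodule.smul_mem (Submodule.span ℂ
        ((fun m => blk 0 ((v m).toVec ℓ) 0) '' {m | q.succAbove m < q})) κ
        (Submodule.subset_span ⟨m, hmq, rfl⟩)
      rwa [blk_smul, mul_zero] at this
    · push Not at hbefore
      obtain ⟨m₀, a, hm₀⟩ := hhat
      obtain ⟨m, hm⟩ := hv.exists_hatOne hi hm₀
      obtain ⟨κ, w, hw0, hw, hκ⟩ := hmove (m := m) (a := a) (by rw [hm]; rfl)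
      by_cases hκ0 : κ = 0
      · refine key_eq (isBorelMap_unipMap hw0) hneg (hunip hw) one_ne_zero ?_
        rw [hκ, hκ0, StdVec.toVec, e_neg_one, one_smul, zero_smul]
      · have hval := hv.valid m
        rw [hm] at hval
        simp only [StdVec.Valid] at hval
        have hstd : IsStdSeq (ℓ + 1) (insertSeq q (.hatTwo (a + 1) 1) v) := by
          refine isStdSeq_insertSeq hv ?_ rfl (fun a ha => by cases ha) (Or.inr fun m b hb => ?_)
          · exact ⟨le_rfl, by omega, by push_cast; omega⟩
          · exact lt_of_le_of_ne (hbefore m b hb) (Fin.succAbove_ne q m).symm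
        -- The torus element multiplies e_{-1} by κ, turning κ ê_{a+1} + e_{-1} into κ ê_{a+1,-1}
        -- (indices after the shift).
        refine key_eq (f := diagMap κ⁻¹ LinearMap.id ∘ₗ unipMap w) (c := κ)
          ((isBorelMap_diagMap (inv_ne_zero hκ0) (IsBorelMap.id ℓ)).comp (isBorelMap_unipMap hw0)) hstd
          (fun m => ?_) hκ0 ?_
        · rw [LinearMap.comp_apply, hunip hw, diagMap_blk]
          simp
        · rw [LinearMap.comp_apply, hκ, diagMap_blk, hm, StdVec.toVec, StdVec.toVec,
            hat_add_one (i := a) (by omega), e_neg_one, blk_add, blk_smul]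
          simp
  · -- the inserted vector is moved into the span of `e_1`, `e_0`, `e_{-1}`
    have hall : ∀ m, ∃ j, v m = .basis j := fun m => by
      rcases (v m).basis_or_isHat with h | ⟨a, ha⟩
      · exact h
      · exact absurd ⟨m, a, ha⟩ hhat
    have hv0 : ∀ m, (v m).toVec ℓ (mid ℓ) = 0 := fun m => by
      obtain ⟨j, hj⟩ := hall m
      rw [hj]
      exact e_mid (hbasis hj)
    set c : ℂ := y (mid ℓ) with hc
    have hw0 : (c • e ℓ 0 - y) (mid ℓ) = 0 := by
      simp [e, coordLabel_mid, hc]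
    have hw : ∀ m, form ((v m).toVec ℓ) (c • e ℓ 0 - y) = 0 := fun m => by
      rw [form_sub_right, form_smul_right, form_e_zero, hv0, form_comm, hy]
      ring
    have h00 : form (e ℓ 0) (e ℓ 0) = 1 := by
      simp [form_e_zero, e, coordLabel_mid]
    have hx : unipMap (c • e ℓ 0 - y) (blk p y 1) = blk (-c ^ 2 / 2) (c • e ℓ 0) 1 := by
      rw [unipMap_blk, blk_inj]
      refine ⟨?_, ?_, rfl⟩
      · have h1 : form y (e ℓ 0) = c := form_e_zero ℓ y
        have h2 : form (e ℓ 0) y = c := by rw [form_comm, h1]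
        simp only [form_sub_left, form_sub_right, form_smul_left, form_smul_right, h1, h2, h00]
        linear_combination (1 / 2 : ℂ) * hyy
      · rw [one_smul, add_sub_cancel]
    by_cases hc0 : c = 0
    · refine key_eq (isBorelMap_unipMap hw0) hneg (hunip hw) one_ne_zero ?_
      rw [hx, hc0, StdVec.toVec, e_neg_one]
      simp
    · have hstd : IsStdSeq (ℓ + 1) (insertSeq q (.hatOne 1) v) := by
        refine isStdSeq_insertSeq hv ?_ rfl (fun _ _ => hall) (Or.inr fun m b hb => ?_)
        · exact ⟨le_rfl, by push_cast; omega⟩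
        · exact absurd ⟨m, b, hb⟩ hhat
      have hs := sqrt_two_mul_self
      have hs0 := sqrt_two_ne_zero
      set s : ℂ := ((Real.sqrt 2 : ℝ) : ℂ)
      -- Scaling e_1 by −√2/c and e_{-1} by −c/√2 turns −(c²/2) e_1 + c e_0 + e_{-1} into (c/√2)
      -- ê_1.
      have ht : -s / c ≠ 0 := div_ne_zero (neg_ne_zero.mpr hs0) hc0
      refine key_eq (f := diagMap (-s / c) LinearMap.id ∘ₗ unipMap (c • e ℓ 0 - y)) (c := c / s)
        ((isBorelMap_diagMap ht (IsBorelMap.id ℓ)).comp (isBorelMap_unipMap hw0)) hstd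
        (fun m => ?_) (div_ne_zero hc0 hs0) ?_
      · rw [LinearMap.comp_apply, hunip hw, diagMap_blk]
        simp
      · rw [LinearMap.comp_apply, hx, diagMap_blk, StdVec.toVec, hat_one, blk_smul, blk_inj]
        refine ⟨?_, ?_, ?_⟩
        · field_simp
          linear_combination hs
        · rw [LinearMap.id_apply, smul_smul, div_mul_cancel₀ _ hs0]
        · field_simp

/-- Every flag is moved to a flag in standard form by some Borel map. -/
theorem exists_borelMap_std (ℓ : ℕ) (F : IsoFlag ℓ) :
    ∃ f, IsBorelMap ℓ f ∧ ∃ v : Fin ℓ → StdVec, IsStdSeq ℓ v ∧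
      (fun i => (F.V i).map f) = spanIic fun i => (v i).toVec ℓ := by
  induction ℓ with
  | zero =>
    refine ⟨LinearMap.id, IsBorelMap.id 0, Fin.elim0, ?_, funext fun i => i.elim0⟩
    exact ⟨fun i => i.elim0, fun i => i.elim0, fun i => i.elim0, fun m h1 h2 => by
      push_cast at h2
      omega⟩
  | succ ℓ ih =>
    obtain ⟨q, x, hx, hF, hlast, hq⟩ := F.exists_adapted
    have hiso : ∀ u ∈ F.V (Fin.last ℓ), ∀ w ∈ F.V (Fin.last ℓ), form u w = 0 :=
      F.isotropic (Fin.last ℓ)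
    have hxm : ∀ i, x i ∈ F.V (Fin.last ℓ) := fun i => hF ▸ mem_spanIic (Fin.le_last i)
    have hblk : ∀ m, ∃ p y, x (q.succAbove m) = blk p y 0 := fun m => by
      obtain ⟨p, y, r, h⟩ := exists_blk (x (q.succAbove m))
      have := hlast m
      rw [h, blk_last] at this
      exact ⟨p, y, by rw [h, this]⟩
    choose p y hpy using hblk
    have hyy : ∀ i j, form (y i) (y j) = 0 := fun i j => by
      have := hiso _ (hxm (q.succAbove i)) _ (hxm (q.succAbove j))
      rw [hpy, hpy, form_blk] at this
      simpa using this
    -- A relation among the y_m makes the same combination of the x_m a multiple of e_1. That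
    -- multiple is 0: by independence if x_q = e_1, and otherwise by pairing with x_q, whose
    -- e_{-1}-coefficient is 1.
    have hli : LinearIndependent ℂ y := by
      have hx' := hx.comp _ (Fin.strictMono_succAbove q).injective
      rw [Fintype.linearIndependent_iff] at hx' ⊢
      intro c hc
      have h1 : ∑ m, c m • x (q.succAbove m) = blk (∑ m, c m * p m) 0 0 := by
        obtain ⟨P, Y, R, h⟩ := exists_blk (∑ m, c m • x (q.succAbove m))
        rw [h, blk_inj]
        refine ⟨?_, ?_, ?_⟩
        · rw [← blk_first P Y R, ← h, Finset.sum_apply]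
          refine Finset.sum_congr rfl fun m _ => ?_
          rw [hpy, Pi.smul_apply, blk_first, smul_eq_mul]
        · rw [← innerL_blk P R Y, ← h, map_sum, ← hc]
          refine Finset.sum_congr rfl fun m _ => ?_
          rw [map_smul, hpy, innerL_blk]
        · rw [← blk_last P Y R, ← h, Finset.sum_apply]
          refine Finset.sum_eq_zero fun m _ => ?_
          rw [Pi.smul_apply, hlast, smul_zero]
      have hmem : ∑ m, c m • x (q.succAbove m) ∈
          Submodule.span ℂ (x '' Set.range q.succAbove) :=
        Submodule.sum_mem _ fun m _ => Submodule.smul_mem _ _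
          (Submodule.subset_span ⟨_, ⟨m, rfl⟩, rfl⟩)
      have h2 : ∑ m, c m * p m = 0 := by
        by_contra h0
        rcases hq with hq | hq
        · refine hx.notMem_span_image (s := Set.range q.succAbove) (x := q) (by simp) ?_
          have h3 := Submodule.smul_mem _ (∑ m, c m * p m)⁻¹ hmem
          rw [h1, blk_smul, inv_mul_cancel₀ h0, mul_zero, smul_zero, ← hq] at h3
          exact h3
        · obtain ⟨P, Y, R, h⟩ := exists_blk (x q)
          have h3 : form (∑ m, c m • x (q.succAbove m)) (x q) = 0 :=
            hiso _ (Submodule.sum_mem _ fun m _ => Submodule.smul_mem _ _ (hxm _)) _ (hxm q)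
          rw [h, blk_last] at hq
          rw [h1, h, form_blk, form_zero_left, hq] at h3
          apply h0
          simpa using h3
      refine hx' c ?_
      rw [h2, blk_zero] at h1
      exact h1
    -- remove the components along `e_1`
    obtain ⟨w, hw0, hw⟩ := exists_form_eq hli hyy p
    obtain ⟨g, hg, v, hv, hgv⟩ := ih (IsoFlag.ofFamily y hli hyy)
    set f := diagMap 1 g ∘ₗ unipMap w with hf
    have hfB : IsBorelMap (ℓ + 1) f :=
      (isBorelMap_diagMap one_ne_zero hg).comp (isBorelMap_unipMap hw0)
    have hfx : ∀ m, f (x (q.succAbove m)) = blk 0 (g (y m)) 0 := fun m => by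
      rw [hf, LinearMap.comp_apply, hpy, unipMap_blk, hw, diagMap_blk]
      simp
    have hgv' : spanIic (fun m => g (y m)) = spanIic fun m => (v m).toVec ℓ := by
      rw [← hgv]
      funext i
      exact (map_spanIic g y i).symm
    have hchain : spanIic (fun m => blk 0 (g (y m)) 0) =
        spanIic fun m => blk 0 ((v m).toVec ℓ) 0 := by
      funext i
      have h1 := congrArg (Submodule.map (blkL ℓ)) (congrFun hgv' i)
      rw [map_spanIic, map_spanIic] at h1
      exact h1
    have hmap : (fun i => (F.V i).map f) =
        spanIic (q.insertNth (α := fun _ => Vec (2 * (ℓ + 1) + 1)) (f (x q))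
          fun m => blk 0 ((v m).toVec ℓ) 0) := by
      rw [← spanIic_insertNth_congr q hchain one_ne_zero (by rw [one_smul, sub_self]; exact zero_mem _)]
      funext i
      rw [hF, map_spanIic]
      congr 1
      funext m
      induction m using Fin.succAboveCases q with
      | x => rw [Fin.insertNth_apply_same]
      | p m => rw [Fin.insertNth_apply_succAbove, hfx]
    have hv_mem : ∀ m, blk 0 ((v m).toVec ℓ) 0 ∈ (F.V (Fin.last ℓ)).map f := fun m => by
      have h1 := mem_spanIic (u := q.insertNth (α := fun _ => Vec (2 * (ℓ + 1) + 1)) (f (x q))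
          fun m => blk 0 ((v m).toVec ℓ) 0) (Fin.le_last (q.succAbove m))
      rw [Fin.insertNth_apply_succAbove] at h1
      rw [congrFun hmap (Fin.last ℓ)]
      exact h1
    have hiso' : ∀ u ∈ (F.V (Fin.last ℓ)).map f, ∀ w ∈ (F.V (Fin.last ℓ)).map f,
        form u w = 0 := by
      rintro _ ⟨u, hu, rfl⟩ _ ⟨w, hw, rfl⟩
      rw [hfB.isometry]
      exact hiso u hu w hw
    have hiv : IsotropicSeq ℓ v := fun i j => by
      rw [← form_blk_zero]
      exact hiso' _ (hv_mem i) _ (hv_mem j)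
    -- The map f fixes e_1 and does not change the e_{-1}-coefficient, so the dichotomy for x_q
    -- persists for its image.
    rcases hq with hq | hq
    · refine ⟨f, hfB, insertSeq q (.basis 1) v, ?_, ?_⟩
      · refine isStdSeq_insertSeq hv ?_ rfl (fun a ha => by cases ha) (Or.inl ⟨_, rfl⟩)
        simp only [StdVec.Valid]
        push_cast
        omega
      · rw [hmap, toVec_insertSeq q _ hv.valid, StdVec.toVec, e_one, hf, LinearMap.comp_apply, hq,
          unipMap_blk, diagMap_blk]
        simp [form_zero_left]
    · obtain ⟨P, Y, R, h⟩ := exists_blk (f (x q))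
      have hR : R = 1 := by
        obtain ⟨P', Y', R', h'⟩ := exists_blk (x q)
        rw [h', blk_last] at hq
        rw [hf, LinearMap.comp_apply, h', unipMap_blk, diagMap_blk, blk_inj, hq] at h
        rw [← h.2.2]
        simp
      rw [h, hR] at hmap
      have hfq : blk P Y 1 ∈ (F.V (Fin.last ℓ)).map f := by
        rw [← hR, ← h]
        exact Submodule.mem_map_of_mem (hxm q)
      obtain ⟨f', hf', z, hz, hzf⟩ := exists_std_of_inner hv hiv q (p := P) (y := Y)
        (fun m => by
          have := hiso' _ hfq _ (hv_mem m)
          rw [form_blk] at this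
          simpa using this)
        (by
          have := hiso' _ hfq _ hfq
          rw [form_blk] at this
          linear_combination this)
      refine ⟨f' ∘ₗ f, hf'.comp hfB, _, hz, ?_⟩
      rw [← hzf, ← hmap]
      funext i
      exact Submodule.map_comp f f' _

/-! ### Splitting a sequence at its hat vectors -/

namespace StdVec

/-- The index of a hat vector. -/
def hatIndex : StdVec → Option ℤ
  | .basis _ => none
  | .hatOne i => some i
  | .hatTwo _ j => some j

/-- The entry of a signed list corresponding to a vector. -/
def entry : StdVec → ℤ
  | .basis j => j
  | .hatOne i => i
  | .hatTwo _ j => j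

lemma hatIndex_eq_some {x : StdVec} {b : ℤ} :
    x.hatIndex = some b ↔ (∃ a, x.IsHat a) ∧ x.index = b := by
  cases x <;> simp [hatIndex, IsHat, index]

lemma natAbs_entry {x : StdVec} (h : 0 ≤ x.index) : (x.entry.natAbs : ℤ) = x.index := by
  cases x <;> simp only [entry, index, Int.natCast_natAbs] at *
  · exact abs_of_nonneg h
  · exact abs_of_nonneg h

end StdVec

/-- Split a sequence after each hat vector. -/
def splitHats : List StdVec → List (List ℤ) × List ℤ
  | [] => ([], [])
  | .basis j :: l =>
    match splitHats l with
    | ([], τ) => ([], j :: τ)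
    | (σ :: L, τ) => ((j :: σ) :: L, τ)
  | .hatOne i :: l => ([i] :: (splitHats l).1, (splitHats l).2)
  | .hatTwo _ j :: l => ([j] :: (splitHats l).1, (splitHats l).2)

/-- The sequence of vectors with a given parameter `a` attached to lists `L` and `τ`. -/
def seqWith (a : ℤ) (L : List (List ℤ)) (τ : List ℤ) : List StdVec :=
  (L.flatMap fun σ => σ.dropLast.map StdVec.basis ++
    [if σ.getLastD 0 = a then StdVec.hatOne a else StdVec.hatTwo a (σ.getLastD 0)]) ++
  τ.map StdVec.basis

lemma spilSeq_eq (L : List (List ℤ)) (τ : List ℤ) :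
    spilSeq L τ = seqWith ((L.getLastD []).getLastD 0) L τ := rfl

lemma splitHats_append_hat (D : List ℤ) (a k : ℤ) (l : List StdVec) :
    splitHats (D.map StdVec.basis ++
      (if k = a then StdVec.hatOne a else StdVec.hatTwo a k) :: l) =
        ((D ++ [k]) :: (splitHats l).1, (splitHats l).2) := by
  induction D with
  | nil =>
    simp only [List.map_nil, List.nil_append]
    split_ifs with h
    · rw [h]
      rfl
    · rfl
  | cons j D ih =>
    rw [List.map_cons, List.cons_append, splitHats, ih]
    rfl

lemma splitHats_map_basis (τ : List ℤ) : splitHats (τ.map StdVec.basis) = ([], τ) := by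
  induction τ with
  | nil => rfl
  | cons j τ ih => rw [List.map_cons, splitHats, ih]

/-- Each list contributes exactly one hat vector, at its last entry, so the cuts recover the lists
whatever a is. -/
lemma splitHats_seqWith (a : ℤ) (L : List (List ℤ)) (τ : List ℤ) (hL : ∀ σ ∈ L, σ ≠ []) :
    splitHats (seqWith a L τ) = (L, τ) := by
  induction L with
  | nil => exact splitHats_map_basis τ
  | cons σ L ih =>
    have h1 := ih fun σ' h => hL σ' (List.mem_cons_of_mem _ h)
    have h2 : seqWith a (σ :: L) τ = σ.dropLast.map StdVec.basis ++
        (if σ.getLastD 0 = a then StdVec.hatOne a else StdVec.hatTwo a (σ.getLastD 0)) ::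
          seqWith a L τ := by
      simp [seqWith]
    have hσ := hL σ List.mem_cons_self
    rw [h2, splitHats_append_hat, h1, List.getLastD_eq_getLast?, List.getLast?_eq_getLast_of_ne_nil hσ,
      Option.getD_some, List.dropLast_append_getLast hσ]

lemma splitHats_ne_nil (l : List StdVec) : ∀ σ ∈ (splitHats l).1, σ ≠ [] := by
  induction l with
  | nil => simp [splitHats]
  | cons x l ih =>
    cases x with
    | basis j =>
      rw [splitHats]
      rcases h : splitHats l with ⟨_ | ⟨σ, L⟩, τ⟩
      · simp
      · rw [h] at ih
        intro σ' hσ'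
        rcases List.mem_cons.mp hσ' with rfl | h'
        · simp
        · exact ih σ' (List.mem_cons_of_mem _ h')
    | hatOne i =>
      intro σ' hσ'
      rcases List.mem_cons.mp hσ' with rfl | h'
      · simp
      · exact ih σ' h'
    | hatTwo i j =>
      intro σ' hσ'
      rcases List.mem_cons.mp hσ' with rfl | h'
      · simp
      · exact ih σ' h'

/-- This translates condition (c) on indices into the partition condition on the lists. -/
lemma splitHats_flatten (l : List StdVec) :
    (splitHats l).1.flatten ++ (splitHats l).2 = l.map StdVec.entry := by
  induction l with
  | nil => rfl
  | cons x l ih =>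
    cases x with
    | basis j =>
      rw [splitHats, List.map_cons, ← ih]
      rcases h : splitHats l with ⟨_ | ⟨σ, L⟩, τ⟩ <;> simp [StdVec.entry]
    | hatOne i => simpa [splitHats, StdVec.entry] using ih
    | hatTwo i j => simpa [splitHats, StdVec.entry] using ih

/-- This translates the order of the hat indices into the order of the last entries. -/
lemma splitHats_getLastD (l : List StdVec) :
    (splitHats l).1.map (fun σ => σ.getLastD 0) = l.filterMap StdVec.hatIndex := by
  induction l with
  | nil => rfl
  | cons x l ih =>
    cases x with
    | basis j =>
      rw [splitHats, List.filterMap_cons_none rfl, ← ih]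
      have hne := splitHats_ne_nil l
      rcases h : splitHats l with ⟨_ | ⟨σ, L⟩, τ⟩
      · rfl
      · rw [h] at hne
        have hσ := hne σ List.mem_cons_self
        simp [List.getLastD_eq_getLast?, List.getLast?_cons, List.getLast?_eq_getLast_of_ne_nil hσ]
    | hatOne i => simpa [splitHats, StdVec.hatIndex] using ih
    | hatTwo i j => simpa [splitHats, StdVec.hatIndex] using ih

/-- Cutting forgets the parameter and the kind of a hat vector. They are recovered because the
parameter is common and only the first kind has index a. -/
lemma seqWith_splitHats {a : ℤ} {l : List StdVec}
    (hl : ∀ x ∈ l, (∃ j, x = .basis j) ∨ x = .hatOne a ∨ ∃ j, j ≠ a ∧ x = .hatTwo a j) :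
    seqWith a (splitHats l).1 (splitHats l).2 = l := by
  induction l with
  | nil => rfl
  | cons x l ih =>
    have ih' := ih fun y hy => hl y (List.mem_cons_of_mem _ hy)
    rcases hl x List.mem_cons_self with ⟨j, rfl⟩ | rfl | ⟨j, hj, rfl⟩
    · rw [splitHats]
      have hne := splitHats_ne_nil l
      rcases h : splitHats l with ⟨_ | ⟨σ, L⟩, τ⟩
      · rw [h] at ih'
        simpa [seqWith] using ih'
      · rw [h] at ih' hne
        have hσ := hne σ List.mem_cons_self
        have h1 : (j :: σ).dropLast = j :: σ.dropLast := by
          rw [List.dropLast_cons_of_ne_nil hσ]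
        have h2 : (j :: σ).getLastD 0 = σ.getLastD 0 := by
          simp [List.getLastD_eq_getLast?, List.getLast?_cons,
            List.getLast?_eq_getLast_of_ne_nil hσ]
        simp only [seqWith, List.flatMap_cons, h1, h2] at ih' ⊢
        rw [List.map_cons, List.cons_append, List.cons_append, List.cons_append, ih']
    · simpa [splitHats, seqWith] using ih'
    · simpa [splitHats, seqWith, hj] using ih'

/-! ### Ordered signed partitions -/

/-- Lists `L` and `τ` which are the standard ordering of a SPIL of `{0, …, ℓ}`. -/
structure IsSpilData (ℓ : ℕ) (L : List (List ℤ)) (τ : List ℤ) : Prop where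
  ne_nil : ∀ σ ∈ L, σ ≠ []
  last_pos : ∀ σ ∈ L, 0 < σ.getLastD 0
  nodup : ((L.flatten ++ τ).map Int.natAbs).Nodup
  mem_iff : ∀ n, n ∈ (L.flatten ++ τ).map Int.natAbs ↔ 1 ≤ n ∧ n ≤ ℓ
  increasing : L.Pairwise fun σ σ' => σ.getLastD 0 < σ'.getLastD 0

lemma getLast?_eq_getLastD {σ : List ℤ} (h : σ ≠ []) : σ.getLast? = some (σ.getLastD 0) := by
  rw [List.getLastD_eq_getLast?, List.getLast?_eq_getLast_of_ne_nil h, Option.getD_some]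

lemma getLastD_mem {σ : List ℤ} (h : σ ≠ []) : σ.getLastD 0 ∈ σ :=
  List.mem_of_getLast? (getLast?_eq_getLastD h)

lemma mem_absList {σ : List ℤ} {n : ℕ} : n ∈ absList σ ↔ ∃ x ∈ σ, x.natAbs = n := List.mem_map

lemma flatten_map_absList (M : List (List ℤ)) :
    (M.map absList).flatten = M.flatten.map Int.natAbs := by
  rw [List.map_flatten]
  rfl

lemma eq_of_mem_absList {M : List (List ℤ)} (hM : (M.flatten.map Int.natAbs).Nodup)
    {σ σ' : List ℤ} (hσ : σ ∈ M) (hσ' : σ' ∈ M) {n : ℕ} (hn : n ∈ absList σ)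
    (hn' : n ∈ absList σ') : σ = σ' := by
  rw [← flatten_map_absList, List.nodup_flatten, List.pairwise_map] at hM
  by_contra h
  have hs : Std.Symm fun σ σ' : List ℤ => List.Disjoint (absList σ) (absList σ') :=
    ⟨fun _ _ h => h.symm⟩
  exact hM.2.forall hσ hσ' h hn hn'

/-! ### From ordered lists to a SPIL -/

namespace IsSpilData

variable {ℓ : ℕ} {L : List (List ℤ)} {τ : List ℤ} (h : IsSpilData ℓ L τ)

include h

lemma nodup_all : ((L ++ [τ ++ [0]]).flatten.map Int.natAbs).Nodup := by
  rw [List.flatten_append, List.flatten_singleton, ← List.append_assoc, List.map_append]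
  refine List.nodup_append.mpr ⟨h.nodup, by simp, ?_⟩
  rintro n hn m hm rfl
  have := (h.mem_iff n).mp hn
  simp at hm
  omega

lemma ne_zero {x : ℤ} (hx : x ∈ L.flatten ++ τ) : x ≠ 0 := by
  rintro rfl
  have := (h.mem_iff 0).mp (List.mem_map.mpr ⟨0, hx, rfl⟩)
  omega

lemma isOrdering : IsOrdering {σ | σ ∈ L ∨ σ = τ ++ [0]} L τ where
  mem_iff _ := Iff.rfl
  zero_notMem σ hσ h0 :=
    h.ne_zero (List.mem_append_left _ (List.mem_flatten.mpr ⟨σ, hσ, h0⟩)) rfl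
  increasing := h.increasing

lemma isSPIL : IsSPIL (Finset.range (ℓ + 1)) {σ | σ ∈ L ∨ σ = τ ++ [0]} := by
  have hmem : ∀ {σ}, (σ ∈ L ∨ σ = τ ++ [0]) → σ ∈ L ++ [τ ++ [0]] := by
    intro σ hσ
    simpa using hσ
  have hne : ∀ {σ}, (σ ∈ L ∨ σ = τ ++ [0]) → σ ≠ [] := by
    rintro σ (hσ | rfl)
    · exact h.ne_nil σ hσ
    · simp
  have hsigned : ∀ σ, (σ ∈ L ∨ σ = τ ++ [0]) → IsSignedList (Finset.range (ℓ + 1)) σ := by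
    intro σ hσ
    refine ⟨fun x hx => ?_, ?_⟩
    · rw [Finset.mem_range]
      by_cases hx0 : x = 0
      · simp [hx0]
      · have hx' : x ∈ L.flatten ++ τ := by
          rcases hσ with hσ | rfl
          · exact List.mem_append_left _ (List.mem_flatten.mpr ⟨σ, hσ, hx⟩)
          · simp only [List.mem_append, List.mem_singleton, hx0, or_false] at hx
            exact List.mem_append_right _ hx
        have := (h.mem_iff x.natAbs).mp (List.mem_map.mpr ⟨x, hx', rfl⟩)
        omega
    · have h1 := h.nodup_all
      rw [← flatten_map_absList, List.nodup_flatten] at h1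
      exact h1.1 _ (List.mem_map.mpr ⟨σ, hmem hσ, rfl⟩)
  refine ⟨hsigned, ?_, ⟨?_, ?_⟩, ?_, ?_⟩
  · intro σ hσ σ' hσ' heq
    obtain ⟨x, hx⟩ := List.exists_mem_of_ne_nil _ (hne hσ)
    have hx1 : x.natAbs ∈ absList σ := mem_absList.mpr ⟨x, hx, rfl⟩
    exact eq_of_mem_absList h.nodup_all (hmem hσ) (hmem hσ') hx1 (heq ▸ hx1)
  · rintro _ ⟨σ, hσ, rfl⟩
    refine ⟨by simpa [absList] using hne hσ, (hsigned σ hσ).2, fun n hn => ?_⟩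
    obtain ⟨x, hx, rfl⟩ := mem_absList.mp hn
    exact (hsigned σ hσ).1 x hx
  · intro n hn
    have hex : ∃ σ, (σ ∈ L ∨ σ = τ ++ [0]) ∧ n ∈ absList σ := by
      rcases Nat.eq_zero_or_pos n with rfl | hpos
      · exact ⟨τ ++ [0], Or.inr rfl, mem_absList.mpr ⟨0, by simp, rfl⟩⟩
      · rw [Finset.mem_range] at hn
        obtain ⟨x, hx, rfl⟩ := List.mem_map.mp ((h.mem_iff n).mpr ⟨hpos, by omega⟩)
        rcases List.mem_append.mp hx with hx | hx
        · obtain ⟨σ, hσ, hxσ⟩ := List.mem_flatten.mp hx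
          exact ⟨σ, Or.inl hσ, mem_absList.mpr ⟨x, hxσ, rfl⟩⟩
        · exact ⟨τ ++ [0], Or.inr rfl, mem_absList.mpr ⟨x, by simp [hx], rfl⟩⟩
    obtain ⟨σ, hσ, hnσ⟩ := hex
    refine ⟨absList σ, ⟨⟨σ, hσ, rfl⟩, hnσ⟩, ?_⟩
    rintro _ ⟨⟨σ', hσ', rfl⟩, hn'⟩
    rw [eq_of_mem_absList h.nodup_all (hmem hσ) (hmem hσ') hnσ hn']
  · rintro σ (hσ | rfl) x hx
    · rw [getLast?_eq_getLastD (h.ne_nil σ hσ), Option.mem_some_iff] at hx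
      rw [← hx]
      exact (h.last_pos σ hσ).le
    · simp at hx
      exact hx.le
  · rintro σ (hσ | rfl) h0
    · exact absurd h0 (h.isOrdering.zero_notMem σ hσ)
    · simp

end IsSpilData

/-! ### The standard ordering of a SPIL: existence and uniqueness -/

namespace IsSPIL

variable {ℓ : ℕ} {S : Set (List ℤ)} (hS : IsSPIL (Finset.range (ℓ + 1)) S)

include hS

lemma ne_nil {σ : List ℤ} (hσ : σ ∈ S) : σ ≠ [] := by
  have := (hS.pil.1 _ ⟨σ, hσ, rfl⟩).1
  simpa [absList] using this

lemma eq_of_mem {σ σ' : List ℤ} (hσ : σ ∈ S) (hσ' : σ' ∈ S) {n : ℕ} (hn : n ∈ absList σ)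
    (hn' : n ∈ absList σ') : σ = σ' := by
  have hnA := (hS.pil.1 _ ⟨σ, hσ, rfl⟩).2.2 n hn
  exact hS.inj hσ hσ' ((hS.pil.2 n hnA).unique ⟨⟨σ, hσ, rfl⟩, hn⟩ ⟨⟨σ', hσ', rfl⟩, hn'⟩)

lemma exists_zero_list : ∃ τ : List ℤ, τ ++ [0] ∈ S := by
  obtain ⟨_, ⟨⟨σ, hσ, rfl⟩, h0⟩, -⟩ := hS.pil.2 0 (by simp)
  obtain ⟨x, hx, hx0⟩ := mem_absList.mp h0
  obtain rfl : x = 0 := Int.natAbs_eq_zero.mp hx0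
  obtain ⟨τ, rfl⟩ := List.getLast?_eq_some_iff.mp (hS.zero_last σ hσ hx)
  exact ⟨τ, hσ⟩

lemma eq_of_zero_mem {σ σ' : List ℤ} (hσ : σ ∈ S) (hσ' : σ' ∈ S) (h : (0 : ℤ) ∈ σ)
    (h' : (0 : ℤ) ∈ σ') : σ = σ' :=
  hS.eq_of_mem hσ hσ' (mem_absList.mpr ⟨0, h, rfl⟩) (mem_absList.mpr ⟨0, h', rfl⟩)

lemma eq_of_getLastD_eq {σ σ' : List ℤ} (hσ : σ ∈ S) (hσ' : σ' ∈ S)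
    (h : σ.getLastD 0 = σ'.getLastD 0) : σ = σ' :=
  hS.eq_of_mem hσ hσ' (mem_absList.mpr ⟨_, getLastD_mem (hS.ne_nil hσ), rfl⟩)
    (mem_absList.mpr ⟨_, getLastD_mem (hS.ne_nil hσ'), by rw [h]⟩)

lemma isSpilData_of_isOrdering {L : List (List ℤ)} {τ : List ℤ} (h : IsOrdering S L τ) :
    IsSpilData ℓ L τ := by
  have hL : ∀ {σ}, σ ∈ L → σ ∈ S := fun hσ => (h.mem_iff _).mpr (Or.inl hσ)
  have hτ : τ ++ [0] ∈ S := (h.mem_iff _).mpr (Or.inr rfl)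
  have hM : ∀ σ ∈ L ++ [τ ++ [0]], σ ∈ S := by
    intro σ hσ
    rcases List.mem_append.mp hσ with hσ | hσ
    · exact hL hσ
    · rwa [List.mem_singleton.mp hσ]
  have hnodup : (L ++ [τ ++ [0]]).Nodup := by
    refine List.nodup_append.mpr ⟨?_, by simp, ?_⟩
    · refine h.increasing.imp ?_
      rintro σ σ' hlt rfl
      exact lt_irrefl _ hlt
    · rintro σ hσ σ' hσ' rfl
      refine h.zero_notMem σ hσ ?_
      rw [List.mem_singleton.mp hσ']
      simp
  have hall : ((L ++ [τ ++ [0]]).flatten.map Int.natAbs).Nodup := by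
    rw [← flatten_map_absList, List.nodup_flatten, List.pairwise_map]
    refine ⟨fun l hl => ?_, ?_⟩
    · obtain ⟨σ, hσ, rfl⟩ := List.mem_map.mp hl
      exact (hS.signed σ (hM σ hσ)).2
    · refine List.Pairwise.imp_of_mem ?_ hnodup
      intro σ σ' hσ hσ' hne n hn hn'
      exact hne (hS.eq_of_mem (hM σ hσ) (hM σ' hσ') hn hn')
  rw [List.flatten_append, List.flatten_singleton, ← List.append_assoc, List.map_append,
    List.nodup_append] at hall
  refine ⟨fun σ hσ => hS.ne_nil (hL hσ), fun σ hσ => ?_, hall.1, fun n => ⟨fun hn => ?_, ?_⟩,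
    h.increasing⟩
  · have hne := hS.ne_nil (hL hσ)
    have h1 := hS.last_nonneg σ (hL hσ) (σ.getLastD 0) (by rw [getLast?_eq_getLastD hne]; rfl)
    -- A last entry is non-negative, and 0 belongs only to the list `τ ++ [0]`.
    refine lt_of_le_of_ne h1 fun h0 => h.zero_notMem σ hσ ?_
    rw [h0]
    exact getLastD_mem hne
  · have h0 : n ≠ 0 := hall.2.2 n hn 0 (by simp)
    obtain ⟨x, hx, rfl⟩ := List.mem_map.mp hn
    have hx' : ∃ σ ∈ S, x ∈ σ := by
      rcases List.mem_append.mp hx with hx | hx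
      · obtain ⟨σ, hσ, hxσ⟩ := List.mem_flatten.mp hx
        exact ⟨σ, hL hσ, hxσ⟩
      · exact ⟨_, hτ, List.mem_append_left _ hx⟩
    obtain ⟨σ, hσ, hxσ⟩ := hx'
    have := Finset.mem_range.mp ((hS.signed σ hσ).1 x hxσ)
    omega
  · rintro ⟨h1, h2⟩
    obtain ⟨_, ⟨⟨σ, hσ, rfl⟩, hn⟩, -⟩ := hS.pil.2 n (Finset.mem_range.mpr (by omega))
    obtain ⟨x, hx, rfl⟩ := mem_absList.mp hn
    refine List.mem_map.mpr ⟨x, ?_, rfl⟩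
    rcases (h.mem_iff σ).mp hσ with hσ' | rfl
    · exact List.mem_append_left _ (List.mem_flatten.mpr ⟨σ, hσ', hx⟩)
    · rcases List.mem_append.mp hx with hx | hx
      · exact List.mem_append_right _ hx
      · rw [List.mem_singleton.mp hx] at h1
        simp at h1

/-- A list is determined by its last entry, so running through the last entries n ≤ ℓ in increasing
order enumerates the lists without 0 in the required order. -/
lemma exists_isOrdering : ∃ L τ, IsOrdering S L τ := by
  classical
  obtain ⟨τ, hτ⟩ := hS.exists_zero_list
  let P : ℕ → Prop := fun n => ∃ σ ∈ S, (0 : ℤ) ∉ σ ∧ σ.getLastD 0 = n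
  have hP : ∀ n, ∃ σ : List ℤ, P n → σ ∈ S ∧ (0 : ℤ) ∉ σ ∧ σ.getLastD 0 = n := fun n => by
    by_cases h : P n
    · obtain ⟨σ, hσ⟩ := h
      exact ⟨σ, fun _ => hσ⟩
    · exact ⟨[], fun h' => absurd h' h⟩
  choose c hc using hP
  have hmem : ∀ {σ}, σ ∈ ((List.range (ℓ + 1)).filter fun n => P n).map c ↔
      σ ∈ S ∧ (0 : ℤ) ∉ σ := by
    intro σ
    rw [List.mem_map]
    constructor
    · rintro ⟨n, hn, rfl⟩
      have h := hc n (by simpa using (List.mem_filter.mp hn).2)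
      exact ⟨h.1, h.2.1⟩
    · rintro ⟨hσ, h0⟩
      have hne := hS.ne_nil hσ
      have hnn := hS.last_nonneg σ hσ (σ.getLastD 0) (by rw [getLast?_eq_getLastD hne]; rfl)
      have hlast := (hS.signed σ hσ).1 _ (getLastD_mem hne)
      have hPn : P (σ.getLastD 0).natAbs := ⟨σ, hσ, h0, by omega⟩
      refine ⟨(σ.getLastD 0).natAbs, ?_, ?_⟩
      · rw [List.mem_filter, List.mem_range]
        exact ⟨Finset.mem_range.mp hlast, by simpa using hPn⟩
      · have h := hc _ hPn
        exact hS.eq_of_getLastD_eq h.1 hσ (by rw [h.2.2]; omega)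
  refine ⟨((List.range (ℓ + 1)).filter fun n => P n).map c, τ, fun σ => ?_,
    fun σ hσ => (hmem.mp hσ).2, ?_⟩
  · rw [hmem]
    constructor
    · intro hσ
      by_cases h0 : (0 : ℤ) ∈ σ
      · exact Or.inr (hS.eq_of_zero_mem hσ hτ h0 (by simp))
      · exact Or.inl ⟨hσ, h0⟩
    · rintro (h | rfl)
      · exact h.1
      · exact hτ
  · rw [List.pairwise_map]
    refine List.Pairwise.imp_of_mem ?_ (List.pairwise_lt_range.filter _)
    intro n m hn hm hlt
    rw [(hc n (by simpa using (List.mem_filter.mp hn).2)).2.2,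
      (hc m (by simpa using (List.mem_filter.mp hm).2)).2.2]
    exact_mod_cast hlt

/-- The set S fixes the members of L, and a strictly increasing list is determined by its members; τ
comes from the only list containing 0. -/
lemma isOrdering_unique {L L' : List (List ℤ)} {τ τ' : List ℤ} (h : IsOrdering S L τ)
    (h' : IsOrdering S L' τ') : L = L' ∧ τ = τ' := by
  constructor
  · have key : ∀ {M M' : List (List ℤ)} {ρ ρ' : List ℤ}, IsOrdering S M ρ → IsOrdering S M' ρ' →
        ∀ σ ∈ M, σ ∈ M' := by
      intro M M' ρ ρ' hM hM' σ hσ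
      rcases (hM'.mem_iff σ).mp ((hM.mem_iff σ).mpr (Or.inl hσ)) with h1 | rfl
      · exact h1
      · exact absurd (by simp) (hM.zero_notMem _ hσ)
    have hnodup : ∀ {M : List (List ℤ)} {ρ : List ℤ}, IsOrdering S M ρ → M.Nodup := by
      intro M ρ hM
      refine hM.increasing.imp ?_
      rintro σ σ' hlt rfl
      exact lt_irrefl _ hlt
    refine List.Perm.eq_of_pairwise (le := fun σ σ' => σ.getLastD 0 < σ'.getLastD 0) ?_
      h.increasing h'.increasing
      ((List.perm_ext_iff_of_nodup (hnodup h) (hnodup h')).mpr fun σ => ⟨key h h' σ, key h' h σ⟩)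
    intro σ σ' _ _ h1 h2
    exact absurd h1 h2.not_gt
  · have h1 := hS.eq_of_zero_mem ((h.mem_iff _).mpr (Or.inr rfl)) ((h'.mem_iff _).mpr (Or.inr rfl))
      (by simp) (by simp)
    exact List.append_cancel_right h1

end IsSPIL

/-! ### Sequences in standard form and ordered signed partitions -/

lemma StdVec.IsHat.form_basis_eq_zero {ℓ : ℕ} {x : StdVec} {a j : ℤ} (hx : x.IsHat a)
    (hxv : x.Valid ℓ) (hj : (StdVec.basis j).Valid ℓ) (hj0 : j ≠ 0) (hja : |j| ≠ a)
    (hxj : x.index ≠ |j|) : form (x.toVec ℓ) (e ℓ j) = 0 := by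
  have hcases := abs_cases j
  cases x with
  | basis k => exact hx.elim
  | hatOne i =>
    obtain rfl : i = a := hx
    simp only [Valid, toVec] at *
    have h1 : i ≠ -j := by omega
    have h2 : i ≠ j := by omega
    rw [form_hat_e _ hj.1 hj.2 hj0, if_neg h1, if_neg h2, sub_zero]
  | hatTwo i k =>
    obtain rfl : i = a := hx
    simp only [Valid, toVec, index] at *
    have h1 : i ≠ -j := by omega
    have h2 : i ≠ j := by omega
    have h3 : -k ≠ -j := by omega
    rw [form_add_left, form_hat_e _ hj.1 hj.2 hj0, if_neg h1, if_neg h2,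
      form_e_e _ hj.1 hj.2, if_neg h3, sub_zero, add_zero]

lemma StdVec.IsHat.form_isHat_eq_zero {ℓ : ℕ} {x y : StdVec} {a : ℤ} (hx : x.IsHat a)
    (hy : y.IsHat a) (hxv : x.Valid ℓ) (hyv : y.Valid ℓ) :
    form (x.toVec ℓ) (y.toVec ℓ) = 0 := by
  -- the hat vector with a given `a`, up to a vector `e_{-j}` with `j < a`
  have key : ∀ {z : StdVec}, z.IsHat a → z.Valid ℓ → ∃ u, z.toVec ℓ = hat ℓ a + u ∧
      (u = 0 ∨ ∃ j, 1 ≤ j ∧ j < a ∧ u = e ℓ (-j)) ∧ 1 ≤ a ∧ a ≤ ℓ := by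
    intro z hz hzv
    cases z with
    | basis k => exact hz.elim
    | hatOne i =>
      obtain rfl : i = a := hz
      exact ⟨0, (add_zero _).symm, Or.inl rfl, hzv⟩
    | hatTwo i k =>
      obtain rfl : i = a := hz
      simp only [Valid] at hzv
      exact ⟨_, rfl, Or.inr ⟨k, hzv.1, hzv.2.1, rfl⟩, by omega, by omega⟩
  obtain ⟨u, hu, hu', ha1, ha2⟩ := key hx hxv
  obtain ⟨w, hw, hw', -, -⟩ := key hy hyv
  have hhat : ∀ {z : Vec (2 * ℓ + 1)}, (z = 0 ∨ ∃ j, 1 ≤ j ∧ j < a ∧ z = e ℓ (-j)) →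
      form (hat ℓ a) z = 0 := by
    rintro z (rfl | ⟨j, hj1, hj2, rfl⟩)
    · exact form_zero_right _
    · have h1 : a ≠ - -j := by omega
      have h2 : a ≠ -j := by omega
      rw [form_hat_e _ (by omega) (by omega) (by omega), if_neg h1, if_neg h2, sub_zero]
  have huw : form u w = 0 := by
    rcases hu' with rfl | ⟨j, hj1, hj2, rfl⟩
    · exact form_zero_left _
    rcases hw' with rfl | ⟨k, hk1, hk2, rfl⟩
    · exact form_zero_right _
    have h1 : -j ≠ - -k := by omega
    rw [form_e_e _ (by omega) (by omega), if_neg h1]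
  rw [hu, hw, form_add_left, form_add_right, form_add_right, form_hat_hat ha1 ha1 ha2, if_pos rfl,
    hhat hw', form_comm u, hhat hu', huw]
  ring

lemma mem_seqWith {a : ℤ} {L : List (List ℤ)} {τ : List ℤ} {x : StdVec}
    (hx : x ∈ seqWith a L τ) : (∃ j, x = .basis j) ∨
      ∃ σ ∈ L, x = if σ.getLastD 0 = a then .hatOne a else .hatTwo a (σ.getLastD 0) := by
  simp only [seqWith, List.mem_append, List.mem_flatMap, List.mem_map, List.mem_singleton] at hx
  rcases hx with ⟨σ, hσ, ⟨j, -, rfl⟩ | rfl⟩ | ⟨j, -, rfl⟩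
  · exact Or.inl ⟨j, rfl⟩
  · exact Or.inr ⟨σ, hσ, rfl⟩
  · exact Or.inl ⟨j, rfl⟩

lemma hatOne_mem_seqWith {a : ℤ} {L : List (List ℤ)} {τ : List ℤ} {σ : List ℤ} (hσ : σ ∈ L)
    (h : σ.getLastD 0 = a) : StdVec.hatOne a ∈ seqWith a L τ := by
  simp only [seqWith, List.mem_append, List.mem_flatMap, List.mem_singleton]
  exact Or.inl ⟨σ, hσ, Or.inr (by rw [if_pos h])⟩

/-- The last member of a list increasing for `<` on last entries has the largest last entry. -/
lemma getLastD_le_of_pairwise {L : List (List ℤ)}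
    (h : L.Pairwise fun σ σ' => σ.getLastD 0 < σ'.getLastD 0) {σ : List ℤ} (hσ : σ ∈ L) :
    (L.getLastD []) ∈ L ∧ σ.getLastD 0 ≤ (L.getLastD []).getLastD 0 := by
  have hne : L ≠ [] := List.ne_nil_of_mem hσ
  obtain ⟨M, ρ, rfl⟩ := List.eq_nil_or_concat L |>.resolve_left hne
  rw [List.concat_eq_append] at *
  have h1 : (M ++ [ρ]).getLastD [] = ρ := by simp [List.getLastD_eq_getLast?]
  rw [h1]
  refine ⟨by simp, ?_⟩
  rcases List.mem_append.mp hσ with hσ | hσ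
  · exact ((List.pairwise_append.mp h).2.2 σ hσ ρ (by simp)).le
  · rw [List.mem_singleton.mp hσ]

/-- The absolute values of the entries are the indices and run once through 1, …, ℓ. The last
entries are the hat indices; they increase up to a, so ê_a is the last hat vector. Hat vectors with
the same parameter are orthogonal, and the remaining products vanish because the indices are
distinct. -/
lemma IsSpilData.exists_stdSeq {ℓ : ℕ} {L : List (List ℤ)} {τ : List ℤ} (h : IsSpilData ℓ L τ) :
    ∃ v : Fin ℓ → StdVec, List.ofFn v = spilSeq L τ ∧ IsStdSeq ℓ v ∧ IsotropicSeq ℓ v := by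
  set a := (L.getLastD []).getLastD 0 with ha
  have hsplit := splitHats_seqWith a L τ h.ne_nil
  have hentry := splitHats_flatten (seqWith a L τ)
  have hhat := splitHats_getLastD (seqWith a L τ)
  rw [hsplit] at hentry hhat
  simp only at hentry hhat
  have hlen : (seqWith a L τ).length = ℓ := by
    have h1 := congrArg List.length hentry
    rw [List.length_map] at h1
    rw [← h1, ← List.length_map Int.natAbs, ← List.toFinset_card_of_nodup h.nodup]
    have h2 : ((L.flatten ++ τ).map Int.natAbs).toFinset = Finset.Icc 1 ℓ := by
      ext n
      rw [List.mem_toFinset, h.mem_iff, Finset.mem_Icc]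
    rw [h2, Nat.card_Icc, Nat.add_sub_cancel]
  obtain ⟨v, hv⟩ : ∃ v : Fin ℓ → StdVec, List.ofFn v = seqWith a L τ := by
    subst hlen
    exact ⟨(seqWith a L τ).get, List.ofFn_get _⟩
  have hmem : ∀ i, v i ∈ seqWith a L τ := fun i => by
    rw [← hv]
    exact (List.mem_ofFn' v (v i)).mpr ⟨i, rfl⟩
  -- the possible members of the sequence
  have hkind : ∀ i, (∃ j, v i = .basis j) ∨ v i = .hatOne a ∨
      ∃ j, 0 < j ∧ j < a ∧ v i = .hatTwo a j := fun i => by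
    rcases mem_seqWith (hmem i) with hb | ⟨σ, hσ, hx⟩
    · exact Or.inl hb
    · split_ifs at hx with hσa
      · exact Or.inr (Or.inl hx)
      · exact Or.inr (Or.inr ⟨_, h.last_pos σ hσ,
          lt_of_le_of_ne (getLastD_le_of_pairwise h.increasing hσ).2 hσa, hx⟩)
  have hone : ∀ i, (v i).IsHat a → ∃ k, v k = .hatOne a := fun i hi => by
    rcases mem_seqWith (hmem i) with ⟨j, hj⟩ | ⟨σ, hσ, -⟩
    · rw [hj] at hi
      exact hi.elim
    · have h1 := hatOne_mem_seqWith (τ := τ) (getLastD_le_of_pairwise h.increasing hσ).1 ha.symm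
      rw [← hv] at h1
      exact (List.mem_ofFn' v _).mp h1
  have hisHat : ∀ i, (∃ j, v i = .basis j) ∨ (v i).IsHat a := fun i => by
    rcases hkind i with hb | hx | ⟨j, -, -, hx⟩
    · exact Or.inl hb
    · exact Or.inr (by rw [hx]; rfl)
    · exact Or.inr (by rw [hx]; rfl)
  have hentry_mem : ∀ i, 1 ≤ (v i).entry.natAbs ∧ (v i).entry.natAbs ≤ ℓ := fun i => by
    rw [← h.mem_iff, hentry]
    exact List.mem_map.mpr ⟨_, List.mem_map.mpr ⟨_, hmem i, rfl⟩, rfl⟩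
  have hapos : ∀ i, (v i).IsHat a → 1 ≤ a ∧ a ≤ ℓ := fun i hi => by
    obtain ⟨k, hk⟩ := hone i hi
    rcases mem_seqWith (hmem k) with ⟨j, hj⟩ | ⟨σ, hσ, -⟩
    · rw [hj] at hk
      cases hk
    · have h1 := hentry_mem k
      have h2 := h.last_pos _ (getLastD_le_of_pairwise h.increasing hσ).1
      rw [hk] at h1
      simp only [StdVec.entry] at h1
      omega
  have hindex : ∀ i, (v i).index = ((v i).entry.natAbs : ℤ) := fun i => by
    refine (StdVec.natAbs_entry ?_).symm
    rcases hkind i with ⟨j, hx⟩ | hx | ⟨j, hj, -, hx⟩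
    · rw [hx]
      exact abs_nonneg j
    · have := hapos i (by rw [hx]; rfl)
      rw [hx]
      simp only [StdVec.index]
      omega
    · rw [hx]
      exact hj.le
  have hinj : ∀ {i k}, (v i).index = (v k).index → i = k := by
    intro i k hik
    have h1 := h.nodup
    rw [hentry, ← hv, List.map_ofFn, List.map_ofFn, List.nodup_ofFn] at h1
    refine h1 ?_
    rw [hindex, hindex] at hik
    exact_mod_cast hik
  have hpair : ∀ {i k}, i < k → ∀ b ∈ (v i).hatIndex, ∀ c ∈ (v k).hatIndex, b < c := by
    have h1 := h.increasing
    rw [← List.pairwise_map (f := fun σ : List ℤ => σ.getLastD 0) (R := (· < ·)), hhat,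
      List.pairwise_filterMap, ← hv, List.pairwise_ofFn] at h1
    intro i k hik b hb c hc
    exact h1 hik b hb c hc
  have hvalid : ∀ i, (v i).Valid ℓ := fun i => by
    have h1 := hentry_mem i
    rcases hkind i with ⟨j, hx⟩ | hx | ⟨j, hj, hja, hx⟩
    · rw [hx] at h1 ⊢
      simp only [StdVec.entry, StdVec.Valid] at *
      omega
    · have := hapos i (by rw [hx]; rfl)
      rw [hx]
      exact this
    · have := hapos i (by rw [hx]; rfl)
      rw [hx]
      exact ⟨by omega, hja, this.2⟩
  -- Once a hat vector occurs, the index a is taken by ê_a. This excludes e_a and e_{-a}, the basis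
  -- vectors that fail to be orthogonal to every hat vector with parameter a.
  have hbasis : ∀ {i j}, v i = .basis j → j ≠ 0 ∧ ((∃ k, (v k).IsHat a) → |j| ≠ a) := by
    intro i j hij
    refine ⟨?_, ?_⟩
    · rintro rfl
      have := (hentry_mem i).1
      rw [hij] at this
      simp [StdVec.entry] at this
    · rintro ⟨k, hk⟩ hja
      obtain ⟨m, hm⟩ := hone k hk
      have : i = m := hinj (by rw [hij, hm]; exact hja)
      rw [this, hm] at hij
      cases hij
  refine ⟨v, hv, ⟨hvalid, ?_, ?_, ?_⟩, ?_⟩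
  · intro i b hi k hik
    rcases hisHat k with hb | hk
    · exact hb
    · exfalso
      have hba : b = a := by
        rcases hkind i with ⟨j, hx⟩ | hx | ⟨j, -, -, hx⟩ <;> rw [hx] at hi <;> cases hi
        rfl
      have h1 := hpair hik b (by rw [hi]; rfl) (v k).index
        (StdVec.hatIndex_eq_some.mpr ⟨⟨a, hk⟩, rfl⟩)
      rcases hkind k with ⟨j, hx⟩ | hx | ⟨j, -, hja, hx⟩
      · rw [hx] at hk
        exact hk
      · rw [hx] at h1
        simp only [StdVec.index] at h1
        omega
      · rw [hx] at h1
        simp only [StdVec.index] at h1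
        omega
  · intro i k hik b j j' hi hk
    exact hpair hik j (by rw [hi]; rfl) j' (by rw [hk]; rfl)
  · intro m hm1 hm2
    have h1 := (h.mem_iff m.toNat).mpr ⟨by omega, by omega⟩
    rw [hentry, ← hv, List.map_ofFn, List.map_ofFn] at h1
    obtain ⟨i, hi⟩ := (List.mem_ofFn' _ _).mp h1
    simp only [Function.comp_apply] at hi
    have him : (v i).index = m := by
      rw [hindex]
      omega
    exact ⟨i, him, fun k hk => hinj (hk.trans him.symm)⟩
  · intro i k
    rcases hisHat i with ⟨j, hi⟩ | hi
    · rcases hisHat k with ⟨j', hk⟩ | hk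
      · have hkv := hvalid k
        rw [hk] at hkv
        rw [hi, hk]
        refine (form_e_e j hkv.1 hkv.2).trans (if_neg ?_)
        rintro rfl
        have : i = k := hinj (by rw [hi, hk]; exact abs_neg j')
        rw [this, hk] at hi
        have h0 := (hbasis hk).1
        rw [StdVec.basis.injEq] at hi
        omega
      · have hiv := hvalid i
        rw [form_comm, hi]
        rw [hi] at hiv
        refine hk.form_basis_eq_zero (hvalid k) hiv (hbasis hi).1 ((hbasis hi).2 ⟨k, hk⟩)
          fun heq => ?_
        have : k = i := hinj (by rw [hi]; exact heq)
        rw [this, hi] at hk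
        exact hk
    · rcases hisHat k with ⟨j', hk⟩ | hk
      · have hkv := hvalid k
        rw [hk] at hkv ⊢
        refine hi.form_basis_eq_zero (hvalid i) hkv (hbasis hk).1 ((hbasis hk).2 ⟨i, hi⟩)
          fun heq => ?_
        have : i = k := hinj (by rw [hk]; exact heq)
        rw [this, hk] at hi
        exact hi
      · exact hi.form_isHat_eq_zero hk (hvalid i) (hvalid k)

/-- The lists are obtained by cutting after each hat vector. Isotropy is essential: it gives the hat
vectors a common parameter a and forces ê_a to occur, so that `spilSeq` reads off the correct a. -/
lemma IsStdSeq.exists_isSpilData {ℓ : ℕ} {v : Fin ℓ → StdVec} (hv : IsStdSeq ℓ v)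
    (hi : IsotropicSeq ℓ v) : ∃ L τ, IsSpilData ℓ L τ ∧ List.ofFn v = spilSeq L τ := by
  have hentry := splitHats_flatten (List.ofFn v)
  have hhat := splitHats_getLastD (List.ofFn v)
  have hne := splitHats_ne_nil (List.ofFn v)
  have hnat : ∀ i, ((v i).entry.natAbs : ℤ) = (v i).index := fun i =>
    StdVec.natAbs_entry (by have := hv.index_mem i; omega)
  have hlast : ∀ σ ∈ (splitHats (List.ofFn v)).1,
      ∃ i, (∃ a, (v i).IsHat a) ∧ (v i).index = σ.getLastD 0 := by
    intro σ hσ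
    have h1 := List.mem_map_of_mem (f := fun σ : List ℤ => σ.getLastD 0) hσ
    rw [hhat, List.mem_filterMap] at h1
    obtain ⟨x, hx, hxσ⟩ := h1
    obtain ⟨i, rfl⟩ := (List.mem_ofFn' _ _).mp hx
    exact ⟨i, StdVec.hatIndex_eq_some.mp hxσ⟩
  have hlast' : ∀ {i a}, (v i).IsHat a →
      ∃ σ ∈ (splitHats (List.ofFn v)).1, σ.getLastD 0 = (v i).index := by
    intro i a ha
    rw [← List.mem_map (f := fun σ : List ℤ => σ.getLastD 0), hhat, List.mem_filterMap]
    exact ⟨v i, (List.mem_ofFn' _ _).mpr ⟨i, rfl⟩, StdVec.hatIndex_eq_some.mpr ⟨⟨a, ha⟩, rfl⟩⟩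
  have hinc : (splitHats (List.ofFn v)).1.Pairwise fun σ σ' => σ.getLastD 0 < σ'.getLastD 0 := by
    rw [← List.pairwise_map (f := fun σ : List ℤ => σ.getLastD 0) (R := (· < ·)), hhat,
      List.pairwise_filterMap, List.pairwise_ofFn]
    intro i k hik b hb c hc
    obtain ⟨⟨a, ha⟩, rfl⟩ := StdVec.hatIndex_eq_some.mp hb
    obtain ⟨⟨a', ha'⟩, rfl⟩ := StdVec.hatIndex_eq_some.mp hc
    exact hv.index_lt_of_isHat hi ha ha' hik
  refine ⟨(splitHats (List.ofFn v)).1, (splitHats (List.ofFn v)).2,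
    ⟨hne, fun σ hσ => ?_, ?_, fun n => ?_, hinc⟩, ?_⟩
  · obtain ⟨i, -, h⟩ := hlast σ hσ
    rw [← h]
    have := (hv.index_mem i).1
    omega
  · rw [hentry, List.map_ofFn, List.map_ofFn, List.nodup_ofFn]
    intro i k hik
    refine hv.index_injective ?_
    simp only [Function.comp_apply] at hik
    simp only [← hnat, hik]
  · rw [hentry, List.map_ofFn, List.map_ofFn, List.mem_ofFn']
    constructor
    · rintro ⟨i, rfl⟩
      have h1 := hnat i
      have h2 := hv.index_mem i
      simp only [Function.comp_apply]
      omega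
    · rintro ⟨h1, h2⟩
      obtain ⟨i, h3, -⟩ := hv.index_unique n (by omega) (by omega)
      refine ⟨i, ?_⟩
      have h4 := hnat i
      simp only [Function.comp_apply]
      omega
  · rw [spilSeq_eq, seqWith_splitHats]
    intro x hx
    obtain ⟨i, rfl⟩ := (List.mem_ofFn' _ _).mp hx
    rcases (v i).basis_or_isHat with hb | ⟨a, ha⟩
    · exact Or.inl hb
    right
    -- the parameter is the last entry of the last list
    obtain ⟨k, hk⟩ := hv.exists_hatOne hi ha
    have hka : (v k).IsHat a := by
      rw [hk]
      rfl
    have hidx : ∀ {m b}, (v m).IsHat b → m ≠ k → (v m).index < a := by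
      intro m b hb hmk
      have h1 : (v k).index = a := by
        rw [hk]
        rfl
      rcases lt_or_gt_of_ne hmk with hlt | hlt
      · rw [← h1]
        exact hv.index_lt_of_isHat hi hb hka hlt
      · obtain ⟨j, hj⟩ := hv.after_hatOne k a hk m hlt
        rw [hj] at hb
        exact hb.elim
    obtain ⟨σ, hσ, hσk⟩ := hlast' hka
    have hmax := getLastD_le_of_pairwise hinc hσ
    obtain ⟨m, ⟨b, hb⟩, hm⟩ := hlast _ hmax.1
    have hmk : m = k := by
      by_contra hmk
      have h1 := hidx hb hmk
      rw [hσk, ← hm, hk] at hmax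
      exact absurd hmax.2 h1.not_ge
    rw [hmk, hk] at hm
    simp only [StdVec.index] at hm
    rw [← hm]
    cases hvi : v i with
    | basis j =>
      rw [hvi] at ha
      exact ha.elim
    | hatOne c =>
      rw [hvi] at ha
      exact Or.inl (by rw [show c = a from ha])
    | hatTwo c j =>
      rw [hvi] at ha
      obtain rfl : c = a := ha
      have h1 := hv.valid i
      rw [hvi] at h1
      exact Or.inr ⟨j, h1.2.1.ne, rfl⟩

/-! ### The main theorem -/

lemma IsoFlag.isotropicSeq {ℓ : ℕ} {F : IsoFlag ℓ} {v : Fin ℓ → StdVec}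
    (h : F.SpannedBy fun i => (v i).toVec ℓ) : IsotropicSeq ℓ v := by
  intro i j
  have hm : ∀ k, (v k).toVec ℓ ∈ F.V k := fun k => by
    rw [h k]
    exact Submodule.subset_span ⟨k, Set.self_mem_Iic, rfl⟩
  exact F.isotropic (max i j) _ (F.mono (le_max_left i j) (hm i)) _
    (F.mono (le_max_right i j) (hm j))

lemma smul_V {ℓ : ℕ} (b : B ℓ) (F : IsoFlag ℓ) (i : Fin ℓ) :
    (b • F).V i = (F.V i).map (Matrix.mulVecLin b.1.1.1) := rfl

lemma stdSeq_eq_of_smul_eq {ℓ : ℕ} {F F' : IsoFlag ℓ} {v v' : Fin ℓ → StdVec} (b : B ℓ)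
    (hb : b • F = F') (hv : IsStdSeq ℓ v) (hv' : IsStdSeq ℓ v')
    (h : F.SpannedBy fun i => (v i).toVec ℓ) (h' : F'.SpannedBy fun i => (v' i).toVec ℓ) :
    v = v' := by
  have hb' : b⁻¹ • F' = F := by rw [← hb, inv_smul_smul]
  refine stdSeq_eq_of_borelMap hv hv' (IsoFlag.isotropicSeq h) (IsoFlag.isotropicSeq h')
    (isBorelMap_of_mem_B b) (isBorelMap_of_mem_B b⁻¹) (fun i => ?_) fun i => ?_
  · rw [← h i, ← h' i, ← hb, smul_V]
  · rw [← h i, ← h' i, ← hb', smul_V]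

lemma IsStdSeq.exists_flag {ℓ : ℕ} {v : Fin ℓ → StdVec} (hv : IsStdSeq ℓ v)
    (hi : IsotropicSeq ℓ v) : ∃ F : IsoFlag ℓ, F.SpannedBy fun i => (v i).toVec ℓ := by
  obtain ⟨κ, hκ, hlead⟩ := hv.exists_lead
  exact ⟨IsoFlag.ofFamily _ (linearIndependent_of_hasLead hκ fun i => (hlead i).2) hi,
    fun _ => rfl⟩

lemma IsoFlag.eq_of_spannedBy {ℓ : ℕ} {F F' : IsoFlag ℓ} {v : Fin ℓ → Vec (2 * ℓ + 1)}
    (h : F.SpannedBy v) (h' : F'.SpannedBy v) : F = F' :=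
  IsoFlag.ext (funext fun i => (h i).trans (h' i).symm)

theorem orbit_bijective (ℓ : ℕ) :
    Function.Bijective (fun F : {F : IsoFlag ℓ // F.IsStandard} =>
      (Quotient.mk _ F.1 : MulAction.orbitRel.Quotient (B ℓ) (IsoFlag ℓ))) := by
  constructor
  · rintro ⟨F, v, hv, hF⟩ ⟨F', v', hv', hF'⟩ h
    obtain ⟨b, hb⟩ := MulAction.orbitRel_apply.mp (Quotient.exact h)
    obtain rfl := stdSeq_eq_of_smul_eq b hb hv' hv hF' hF
    exact Subtype.ext (IsoFlag.eq_of_spannedBy hF hF')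
  · intro x
    obtain ⟨F, rfl⟩ := Quotient.exists_rep x
    obtain ⟨f, hf, v, hv, hfv⟩ := exists_borelMap_std ℓ F
    obtain ⟨b, hb⟩ := hf.exists_mem_B
    refine ⟨⟨b • F, v, hv, fun i => ?_⟩, Quotient.sound (MulAction.orbitRel_apply.mpr ⟨b, rfl⟩)⟩
    rw [smul_V, hb]
    exact congrFun hfv i

theorem exists_spil_equiv (ℓ : ℕ) :
    ∃ Γ : SPIL ℓ ≃ {F : IsoFlag ℓ // F.IsStandard},
      ∀ S : SPIL ℓ, ∃ (L : List (List ℤ)) (τ : List ℤ) (v : Fin ℓ → StdVec),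
        IsOrdering S.1 L τ ∧ List.ofFn v = spilSeq L τ ∧
          (Γ S).1.SpannedBy fun i => (v i).toVec ℓ := by
  have hex : ∀ S : SPIL ℓ, ∃ F : {F : IsoFlag ℓ // F.IsStandard}, ∃ (L : List (List ℤ))
      (τ : List ℤ) (v : Fin ℓ → StdVec), IsStdSeq ℓ v ∧ IsOrdering S.1 L τ ∧
        List.ofFn v = spilSeq L τ ∧ F.1.SpannedBy fun i => (v i).toVec ℓ := by
    intro S
    obtain ⟨L, τ, hLτ⟩ := S.2.exists_isOrdering
    obtain ⟨v, hv, hstd, hiso⟩ := (S.2.isSpilData_of_isOrdering hLτ).exists_stdSeq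
    obtain ⟨F, hF⟩ := hstd.exists_flag hiso
    exact ⟨⟨F, v, hstd, hF⟩, L, τ, v, hstd, hLτ, hv, hF⟩
  choose Γ L τ v hstd hord hseq hspan using hex
  have hinj : Function.Injective Γ := by
    intro S S' h
    -- Uniqueness in an orbit, applied to the identity element, shows that a flag has only one
    -- standard sequence; cutting it recovers the ordered lists and hence the SPIL.
    have hv : v S = v S' := stdSeq_eq_of_smul_eq 1 (one_smul _ _) (hstd S) (hstd S') (hspan S)
      (h ▸ hspan S')
    have hd := S.2.isSpilData_of_isOrdering (hord S)
    have hd' := S'.2.isSpilData_of_isOrdering (hord S')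
    have h1 : spilSeq (L S) (τ S) = spilSeq (L S') (τ S') := by rw [← hseq, ← hseq, hv]
    have h2 := congrArg splitHats h1
    rw [spilSeq_eq, spilSeq_eq, splitHats_seqWith _ _ _ hd.ne_nil,
      splitHats_seqWith _ _ _ hd'.ne_nil, Prod.mk.injEq] at h2
    refine Subtype.ext (Set.ext fun σ => ?_)
    rw [(hord S).mem_iff, (hord S').mem_iff, h2.1, h2.2]
  have hsurj : Function.Surjective Γ := by
    rintro ⟨F, w, hw, hF⟩
    obtain ⟨M, ρ, hd, hM⟩ := hw.exists_isSpilData (IsoFlag.isotropicSeq hF)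
    let S : SPIL ℓ := ⟨_, hd.isSPIL⟩
    refine ⟨S, Subtype.ext ?_⟩
    obtain ⟨h1, h2⟩ := S.2.isOrdering_unique (hord S) hd.isOrdering
    have hvw : v S = w := List.ofFn_injective (by rw [hseq, hM, h1, h2])
    have h3 := hspan S
    rw [hvw] at h3
    exact IsoFlag.eq_of_spannedBy h3 hF
  exact ⟨Equiv.ofBijective Γ ⟨hinj, hsurj⟩, fun S => ⟨L S, τ S, v S, hord S, hseq S, hspan S⟩⟩

end

end OrthFlag

theorem mainTheorem7 (ℓ : ℕ) :
    -- every `B_{2ℓ}`-orbit contains exactly one flag in standard form: `F ↦ B_{2ℓ} · F` is a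
    -- bijection from flags in standard form onto orbits
    Function.Bijective
      (fun F : {F : OrthFlag.IsoFlag ℓ // F.IsStandard} =>
        (Quotient.mk _ F.1 :
          MulAction.orbitRel.Quotient (OrthFlag.B ℓ) (OrthFlag.IsoFlag ℓ))) ∧
    -- the explicit bijection from `SPIL(ℓ ∪ {0})` onto flags in standard form
    ∃ Γ : OrthFlag.SPIL ℓ ≃ {F : OrthFlag.IsoFlag ℓ // F.IsStandard},
      ∀ S : OrthFlag.SPIL ℓ, ∃ (L : List (List ℤ)) (τ : List ℤ) (v : Fin ℓ → OrthFlag.StdVec),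
        OrthFlag.IsOrdering S.1 L τ ∧ List.ofFn v = OrthFlag.spilSeq L τ ∧
          (Γ S).1.SpannedBy fun i => (v i).toVec ℓ :=
  ⟨OrthFlag.orbit_bijective ℓ, OrthFlag.exists_spil_equiv ℓ⟩
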